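/- **Setting.** Let $f_1,f_2:\mathbb{R}^n\times\mathbb{R}_{\ge 0}\to\mathbb{R}^n$ be continuous and, for $\varepsilon>0$, consider the system $$\dot x=f_\varepsilon(x,\tau):=\varepsilon^{-1}f_1(x,\tau)+f_2(x,\tau),\qquad \dot\tau=\varepsilon^{-2}.\qquad (1)$$ A solution from $(x_0,\tau_0)\in\mathbb{R}^n\times\mathbb{R}_{\ge0}$ is a $C^1$ function on an interval $[0,t_s)$, $0<t_s\le\infty$, with values in $\mathbb{R}^n\times\mathbb{R}_{\ge0}$ satisfying (1) and the initial condition. Class $\mathcal K$: continuous, strictly increasing $\alpha:\mathbb{R}_{\ge0}\to\mathbb{R}_{\ge0}$ with $\alpha(0)=0$; class $\mathcal K_\infty$: in addition unbounded; class $\mathcal{KL}$: continuous $\beta:\mathbb{R}_{\ge0}^2\to\mathbb{R}_{\ge0}$ with $\beta(\cdot,s)\in\mathcal K_\infty$ for all $s\ge0$, $\beta(r,\cdot)$ strictly decreasing for all $r>0$, and $\lim_{s\to\infty}\beta(r,s)=0$ for all $r\ge0$. A function $\phi:\mathbb{R}^n\to\mathbb{R}_{\ge0}$ is called positive definite if $\phi(0)=0$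 and there is $\alpha\in\mathcal K$ with $\alpha(|x|)\le\phi(x)$ for all $x\in\mathbb{R}^n$. **Regularity assumption with constant $\delta_1$ (and period $T>0$).** For $k\in\{1,2\}$: (a) $f_k$ is continuous on $\mathbb{R}^n\times\mathbb{R}_{\ge0}$ and there is $L_k>0$ with $|f_k(x_1,\tau)-f_k(x_2,\tau)|\le L_k|x_1-x_2|$ whenever $|x_1|,|x_2|\ge\delta_1$ and $\tau\ge0$; (b) $f_k(x,\tau+T)=f_k(x,\tau)$ and $\int_0^Tf_1(x,\tau)\,d\tau=0$ for all $(x,\tau)\in\mathbb{R}^n\times\mathbb{R}_{\ge0}$; (c) for each $\tau\ge0$, $f_k(\cdot,\tau)$ is $C^{3-k}$ on an open neighbourhood of $\{|x|\ge\delta_1\}$; (d) there is $L_3>0$ with $|D_xf_1(x_1,\tau_1)f_1(x_1,\tau_2)-D_xf_1(x_2,\tau_1)f_1(x_2,\tau_2)|\le L_3|x_1-x_2|$ whenever $|x_1|,|x_2|\ge\delta_1$ and $\tau_1,\tau_2\ge0$. **Averaging construction.** For $\epsilon>0$ call $\delta=(\delta_1,\delta_2,\delta_3)$ admissible if $\delta_1>0$,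 $\delta_2\ge(1+\epsilon)\delta_1$, $\delta_3>(1+\epsilon)\delta_2$. Let $\chi_1(r)=e^{-1/r}$ for $r>0$ and $\chi_1(r)=0$ for $r\le0$, $\chi_2(r)=\chi_1(r)/(\chi_1(r)+\chi_1(1-r))$, $\varphi(x)=\chi_2\big((|x|-\delta_1)/(\delta_2-\delta_1)\big)$, $\hat f_k=\varphi f_k$, and $$v_1(x,\tau)=\int_0^\tau\hat f_1(x,s)\,ds,\qquad \bar f(x)=\frac1{2T}\int_0^T\Big(2\hat f_2+D_x\hat f_1\,v_1-D_xv_1\,\hat f_1\Big)(x,\tau)\,d\tau,$$ $$w(x,\tau)=\int_0^\tau\big(\hat f_2(x,s)+D_x\hat f_1(x,s)v_1(x,s)-\bar f(x)\big)ds,\qquad v_2=w-D_xv_1\,v_1,$$ $$\Phi(x,\tau)=x-\varepsilon v_1(x,\tau)-\varepsilon^2v_2(x,\tau),\qquad \Psi(x,\tau)=(\Phi(x,\tau),\tau).$$ Under the regularity assumption $\Psi$ is invertible for all small $\varepsilon>0$. Let $g(x,\tau,\varepsilon)=\varepsilon^{-1}\big(\Psi_*f_\varepsilon(x,\tau)-\bar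 f(x)\big)$, where, with $(\xi,\tau)=\Psi^{-1}(x,\tau)$, $\Psi_*f_\varepsilon(x,\tau)=D_x\Phi(\xi,\tau)f_\varepsilon(\xi,\tau)+\varepsilon^{-2}D_\tau\Phi(\xi,\tau)$. **Lyapunov assumption for $\delta$, satisfied by $V$ and $\phi$.** $V:\mathbb{R}^n\to\mathbb{R}_{\ge0}$ is $C^1$, $\phi:\mathbb{R}^n\to\mathbb{R}_{\ge0}$ is positive definite, and there are $\alpha_1,\alpha_2\in\mathcal K_\infty$ and $c_1,c_2>0$ such that: (a) $\alpha_1(|x|)\le V(x)\le\alpha_2(|x|)$ and $|\nabla V(x)|\le c_2\phi(x)$ for all $x\in\mathbb{R}^n$; (b) $\langle\nabla V(x),\bar f(x)\rangle\le-c_1\phi(x)^2$ whenever $|x|\ge\delta_3$; (c) either (i) there are $\bar L_g,\varepsilon_0>0$ with $|g(x,\tau,\varepsilon)|\le\bar L_g(\phi(x)+1)$ whenever $|x|\ge\delta_3$, $\tau\ge0$ and $0<\varepsilon\le\varepsilon_0$, or (ii) there is $\alpha_3\in\mathcal K$ with $\alpha_3(|x|)|x|\le\phi(x)$ for all $x\in\mathbb{R}^n$.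 **Statement.** Suppose that the regularity assumption holds for every $\delta_1>0$ (it may fail for $\delta_1=0$), and that there is a single pair $V,\phi$ that satisfies the Lyapunov assumption for every $\epsilon>0$ and every admissible $\delta$. Then the origin is uniformly globally practically asymptotically stable for (1): there is $\beta\in\mathcal{KL}$ such that for every $\nu>0$ there is $\varepsilon^*>0$ such that, for all $\varepsilon\in(0,\varepsilon^*)$ and all $(x_0,\tau_0)\in\mathbb{R}^n\times\mathbb{R}_{\ge0}$, every solution $(x,\tau)$ of (1) from $(x_0,\tau_0)$ satisfies $|x(t)|\le\beta(|x_0|,t)+\nu$ for all $t$ in its domain, and every maximal solution is defined on $[0,\infty)$. -/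

import Mathlib

open Set Filter Topology MeasureTheory

noncomputable section

namespace SecondOrderAveraging

/-! ### Comparison functions -/

/-- Class `𝒦`: strictly increasing continuous functions on `[0, ∞)` vanishing at `0`. -/
structure ClassK (α : ℝ → ℝ) : Prop where
  continuousOn : ContinuousOn α (Ici 0)
  strictMonoOn : StrictMonoOn α (Ici 0)
  map_zero : α 0 = 0

/-- Class `𝒦_∞`: unbounded class `𝒦` functions. -/
structure ClassKInf (α : ℝ → ℝ) : Prop extends ClassK α where
  tendsto_atTop : Tendsto α atTop atTop

/-- Class `𝒦ℒ`. Strict monotonicity in the second argument is required for `r > 0` only, since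
`β 0 s = 0` for every `s`. -/
structure ClassKL (β : ℝ → ℝ → ℝ) : Prop where
  continuousOn : ContinuousOn (fun p : ℝ × ℝ => β p.1 p.2) (Ici 0 ×ˢ Ici 0)
  classKInf : ∀ s, 0 ≤ s → ClassKInf (fun r => β r s)
  strictAntiOn : ∀ r, 0 < r → StrictAntiOn (β r) (Ici 0)
  tendsto_zero : ∀ r, 0 ≤ r → Tendsto (β r) atTop (𝓝 0)

/-- Positive definite functions on `ℝⁿ`, globally: `φ` vanishes at `0` and is bounded below by a
class `𝒦` function of the norm (in particular `φ x > 0` for `x ≠ 0`). -/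
structure PositiveDefinite {n : ℕ} (φ : EuclideanSpace ℝ (Fin n) → ℝ) : Prop where
  map_zero : φ 0 = 0
  lower_bound : ∃ α : ℝ → ℝ, ClassK α ∧ ∀ x, α ‖x‖ ≤ φ x

/-! ### Systems `ẋ = F ε x τ`, `τ̇ = ε⁻²` on `ℝⁿ × [0, ∞)` and practical stability

The fields are functions of a real `τ`, but only their values for `τ ≥ 0` are ever used. -/

/-- The time interval `[0, tₛ)`, with `tₛ ∈ (0, ∞]`. -/
def timeDomain (ts : EReal) : Set ℝ := {t : ℝ | 0 ≤ t ∧ (t : EReal) < ts}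

/-- `(x, τ)`, restricted to `[0, tₛ)`, is a solution of `ẋ = f(x, τ)`, `τ̇ = ε⁻²` from `(x₀, τ₀)`.
(The derivative at `0` is one-sided. For continuous `f` a solution is automatically `C¹`.) -/
structure IsSolution {n : ℕ} (ε : ℝ)
    (f : EuclideanSpace ℝ (Fin n) → ℝ → EuclideanSpace ℝ (Fin n))
    (x₀ : EuclideanSpace ℝ (Fin n)) (τ₀ : ℝ) (ts : EReal)
    (x : ℝ → EuclideanSpace ℝ (Fin n)) (τ : ℝ → ℝ) : Prop where
  pos : 0 < ts
  init_x : x 0 = x₀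
  init_τ : τ 0 = τ₀
  nonneg : ∀ t ∈ timeDomain ts, 0 ≤ τ t
  deriv_x : ∀ t ∈ timeDomain ts, HasDerivWithinAt x (f (x t) (τ t)) (timeDomain ts) t
  deriv_τ : ∀ t ∈ timeDomain ts, HasDerivWithinAt τ ((ε ^ 2)⁻¹) (timeDomain ts) t

/-- A solution that is not the restriction of a solution on a longer interval. -/
def IsMaximalSolution {n : ℕ} (ε : ℝ)
    (f : EuclideanSpace ℝ (Fin n) → ℝ → EuclideanSpace ℝ (Fin n))
    (x₀ : EuclideanSpace ℝ (Fin n)) (τ₀ : ℝ) (ts : EReal)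
    (x : ℝ → EuclideanSpace ℝ (Fin n)) (τ : ℝ → ℝ) : Prop :=
  IsSolution ε f x₀ τ₀ ts x τ ∧
    ∀ (ts' : EReal) (x' : ℝ → EuclideanSpace ℝ (Fin n)) (τ' : ℝ → ℝ),
      IsSolution ε f x₀ τ₀ ts' x' τ' → ts ≤ ts' →
      (∀ t ∈ timeDomain ts, x' t = x t ∧ τ' t = τ t) → ts' = ts

/-- Uniform global practical asymptotic stability of the origin for `ẋ = F ε x τ`, `τ̇ = ε⁻²`:
the `𝒦ℒ` bound, with an arbitrarily small residual `ν`, holds along every solution, and no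
(maximal) solution ceases to exist in finite time. -/
def UGpAS {n : ℕ}
    (F : ℝ → EuclideanSpace ℝ (Fin n) → ℝ → EuclideanSpace ℝ (Fin n)) : Prop :=
  ∃ β : ℝ → ℝ → ℝ, ClassKL β ∧
    ∀ ν : ℝ, 0 < ν → ∃ εstar : ℝ, 0 < εstar ∧
      ∀ ε : ℝ, 0 < ε → ε < εstar →
        ∀ (x₀ : EuclideanSpace ℝ (Fin n)) (τ₀ : ℝ), 0 ≤ τ₀ →
          ∀ (ts : EReal) (x : ℝ → EuclideanSpace ℝ (Fin n)) (τ : ℝ → ℝ),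
            (IsSolution ε (F ε) x₀ τ₀ ts x τ →
              ∀ t ∈ timeDomain ts, ‖x t‖ ≤ β ‖x₀‖ t + ν) ∧
            (IsMaximalSolution ε (F ε) x₀ τ₀ ts x τ → ts = ⊤)

/-- The oscillatory field `f_ε = ε⁻¹ f₁ + f₂`. -/
def originalField {n : ℕ} (f₁ f₂ : EuclideanSpace ℝ (Fin n) → ℝ → EuclideanSpace ℝ (Fin n))
    (ε : ℝ) (x : EuclideanSpace ℝ (Fin n)) (τ : ℝ) : EuclideanSpace ℝ (Fin n) :=
  ε⁻¹ • f₁ x τ + f₂ x τ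

/-! ### The regularity assumption -/

/-- The regularity assumption on `f₁, f₂` with period `T`, on the region `‖x‖ ≥ δ₁`. Being `C^k` on
a closed set means being `C^k` on an open neighbourhood of it. -/
structure Regularity {n : ℕ} (f₁ f₂ : EuclideanSpace ℝ (Fin n) → ℝ → EuclideanSpace ℝ (Fin n))
    (T δ₁ : ℝ) : Prop where
  continuous₁ : ContinuousOn (fun p : EuclideanSpace ℝ (Fin n) × ℝ => f₁ p.1 p.2) (univ ×ˢ Ici 0)
  continuous₂ : ContinuousOn (fun p : EuclideanSpace ℝ (Fin n) × ℝ => f₂ p.1 p.2) (univ ×ˢ Ici 0)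
  lipschitz₁ : ∃ L : ℝ, 0 < L ∧ ∀ x y : EuclideanSpace ℝ (Fin n), δ₁ ≤ ‖x‖ → δ₁ ≤ ‖y‖ →
    ∀ τ : ℝ, 0 ≤ τ → ‖f₁ x τ - f₁ y τ‖ ≤ L * ‖x - y‖
  lipschitz₂ : ∃ L : ℝ, 0 < L ∧ ∀ x y : EuclideanSpace ℝ (Fin n), δ₁ ≤ ‖x‖ → δ₁ ≤ ‖y‖ →
    ∀ τ : ℝ, 0 ≤ τ → ‖f₂ x τ - f₂ y τ‖ ≤ L * ‖x - y‖
  period_pos : 0 < T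
  periodic₁ : ∀ x τ, 0 ≤ τ → f₁ x (τ + T) = f₁ x τ
  periodic₂ : ∀ x τ, 0 ≤ τ → f₂ x (τ + T) = f₂ x τ
  mean_zero : ∀ x, ∫ τ in (0 : ℝ)..T, f₁ x τ = 0
  smooth₁ : ∀ τ : ℝ, 0 ≤ τ → ∃ U : Set (EuclideanSpace ℝ (Fin n)),
    IsOpen U ∧ {x | δ₁ ≤ ‖x‖} ⊆ U ∧ ContDiffOn ℝ 2 (fun x => f₁ x τ) U
  smooth₂ : ∀ τ : ℝ, 0 ≤ τ → ∃ U : Set (EuclideanSpace ℝ (Fin n)),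
    IsOpen U ∧ {x | δ₁ ≤ ‖x‖} ⊆ U ∧ ContDiffOn ℝ 1 (fun x => f₂ x τ) U
  lipschitz_deriv : ∃ L : ℝ, 0 < L ∧ ∀ x y : EuclideanSpace ℝ (Fin n), δ₁ ≤ ‖x‖ → δ₁ ≤ ‖y‖ →
    ∀ τ₁ τ₂ : ℝ, 0 ≤ τ₁ → 0 ≤ τ₂ →
      ‖fderiv ℝ (fun z => f₁ z τ₁) x (f₁ x τ₂) - fderiv ℝ (fun z => f₁ z τ₁) y (f₁ y τ₂)‖
        ≤ L * ‖x - y‖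

/-! ### Second-order averaging and the near-identity transformation -/

/-- The admissible constants `δ = (δ₁, δ₂, δ₃)` for a given `ϵ > 0`. -/
structure Admissible (ϵ δ₁ δ₂ δ₃ : ℝ) : Prop where
  nonneg : 0 ≤ δ₁
  le : (1 + ϵ) * δ₁ ≤ δ₂
  lt : (1 + ϵ) * δ₂ < δ₃

/-- The smooth reverse bump function: `0` for `‖x‖ ≤ δ₁` and `1` for `‖x‖ ≥ δ₂`.
`Real.smoothTransition r = χ₁ r / (χ₁ r + χ₁ (1 - r))`, where `χ₁ r = exp (-r⁻¹)` for `r > 0` and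
`χ₁ r = 0` for `r ≤ 0`. -/
def bump {n : ℕ} (δ₁ δ₂ : ℝ) (x : EuclideanSpace ℝ (Fin n)) : ℝ :=
  if δ₁ < δ₂ then Real.smoothTransition ((‖x‖ - δ₁) / (δ₂ - δ₁)) else 1

/-- `f̂(x, τ) = φ(x) f(x, τ)`, with `φ` the reverse bump function. -/
def cutoff {n : ℕ} (δ₁ δ₂ : ℝ) (f : EuclideanSpace ℝ (Fin n) → ℝ → EuclideanSpace ℝ (Fin n))
    (x : EuclideanSpace ℝ (Fin n)) (τ : ℝ) : EuclideanSpace ℝ (Fin n) :=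
  bump δ₁ δ₂ x • f x τ

/-- `v₁(x, τ) = ∫₀^τ f̂₁(x, s) ds`. -/
def v₁ {n : ℕ} (f₁ : EuclideanSpace ℝ (Fin n) → ℝ → EuclideanSpace ℝ (Fin n)) (δ₁ δ₂ : ℝ)
    (x : EuclideanSpace ℝ (Fin n)) (τ : ℝ) : EuclideanSpace ℝ (Fin n) :=
  ∫ s in (0 : ℝ)..τ, cutoff δ₁ δ₂ f₁ x s

/-- The second-order average `f̄(x) = (2T)⁻¹ ∫₀^T (2 f̂₂ + [v₁, f̂₁])(x, τ) dτ`, where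
`[v₁, f̂₁] = D_x f̂₁ v₁ - D_x v₁ f̂₁`. -/
def averagedField {n : ℕ} (f₁ f₂ : EuclideanSpace ℝ (Fin n) → ℝ → EuclideanSpace ℝ (Fin n))
    (T δ₁ δ₂ : ℝ) (x : EuclideanSpace ℝ (Fin n)) : EuclideanSpace ℝ (Fin n) :=
  (2 * T)⁻¹ • ∫ τ in (0 : ℝ)..T,
    ((2 : ℝ) • cutoff δ₁ δ₂ f₂ x τ +
      VectorField.lieBracket ℝ (fun y => v₁ f₁ δ₁ δ₂ y τ) (fun y => cutoff δ₁ δ₂ f₁ y τ) x)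

/-- `w(x, τ) = ∫₀^τ (f̂₂(x, s) + D_x f̂₁(x, s) v₁(x, s) - f̄(x)) ds`. -/
def w {n : ℕ} (f₁ f₂ : EuclideanSpace ℝ (Fin n) → ℝ → EuclideanSpace ℝ (Fin n))
    (T δ₁ δ₂ : ℝ) (x : EuclideanSpace ℝ (Fin n)) (τ : ℝ) : EuclideanSpace ℝ (Fin n) :=
  ∫ s in (0 : ℝ)..τ,
    (cutoff δ₁ δ₂ f₂ x s + fderiv ℝ (fun y => cutoff δ₁ δ₂ f₁ y s) x (v₁ f₁ δ₁ δ₂ x s)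
      - averagedField f₁ f₂ T δ₁ δ₂ x)

/-- `v₂(x, τ) = w(x, τ) - D_x v₁(x, τ) v₁(x, τ)`. -/
def v₂ {n : ℕ} (f₁ f₂ : EuclideanSpace ℝ (Fin n) → ℝ → EuclideanSpace ℝ (Fin n))
    (T δ₁ δ₂ : ℝ) (x : EuclideanSpace ℝ (Fin n)) (τ : ℝ) : EuclideanSpace ℝ (Fin n) :=
  w f₁ f₂ T δ₁ δ₂ x τ - fderiv ℝ (fun y => v₁ f₁ δ₁ δ₂ y τ) x (v₁ f₁ δ₁ δ₂ x τ)

/-- The first component `Φ(x, τ) = x - ε v₁(x, τ) - ε² v₂(x, τ)` of the near-identity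
transformation `Ψ(x, τ) = (Φ(x, τ), τ)`. -/
def nearIdentity {n : ℕ} (f₁ f₂ : EuclideanSpace ℝ (Fin n) → ℝ → EuclideanSpace ℝ (Fin n))
    (T δ₁ δ₂ ε : ℝ) (x : EuclideanSpace ℝ (Fin n)) (τ : ℝ) : EuclideanSpace ℝ (Fin n) :=
  x - ε • v₁ f₁ δ₁ δ₂ x τ - ε ^ 2 • v₂ f₁ f₂ T δ₁ δ₂ x τ

/-- The first component of `Ψ⁻¹(x, τ)`; the second one is `τ`, as `Ψ` preserves `τ`. Meaningful
when `Φ(·, τ)` is a bijection, which is the case for all small `ε > 0`. -/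
def nearIdentityInv {n : ℕ} (f₁ f₂ : EuclideanSpace ℝ (Fin n) → ℝ → EuclideanSpace ℝ (Fin n))
    (T δ₁ δ₂ ε : ℝ) (x : EuclideanSpace ℝ (Fin n)) (τ : ℝ) : EuclideanSpace ℝ (Fin n) :=
  Function.invFun (fun ξ => nearIdentity f₁ f₂ T δ₁ δ₂ ε ξ τ) x

/-- The pushforward of `f_ε` under `Ψ`: with `(ξ, τ) = Ψ⁻¹(x, τ)`,
`Ψ_* f_ε (x, τ) = D_x Φ(ξ, τ) f_ε(ξ, τ) + ε⁻² D_τ Φ(ξ, τ)`.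
The derivative in `τ` is taken within `[0, ∞)`. -/
def pushforward {n : ℕ} (f₁ f₂ : EuclideanSpace ℝ (Fin n) → ℝ → EuclideanSpace ℝ (Fin n))
    (T δ₁ δ₂ ε : ℝ) (x : EuclideanSpace ℝ (Fin n)) (τ : ℝ) : EuclideanSpace ℝ (Fin n) :=
  let ξ := nearIdentityInv f₁ f₂ T δ₁ δ₂ ε x τ
  fderiv ℝ (fun y => nearIdentity f₁ f₂ T δ₁ δ₂ ε y τ) ξ (originalField f₁ f₂ ε ξ τ) +
    (ε ^ 2)⁻¹ • derivWithin (fun s => nearIdentity f₁ f₂ T δ₁ δ₂ ε ξ s) (Ici 0) τ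

/-- The remainder `g` of `Ψ_* f_ε = f̄ + ε g`, for `ε > 0`. -/
def remainder {n : ℕ} (f₁ f₂ : EuclideanSpace ℝ (Fin n) → ℝ → EuclideanSpace ℝ (Fin n))
    (T δ₁ δ₂ : ℝ) (x : EuclideanSpace ℝ (Fin n)) (τ ε : ℝ) : EuclideanSpace ℝ (Fin n) :=
  ε⁻¹ • (pushforward f₁ f₂ T δ₁ δ₂ ε x τ - averagedField f₁ f₂ T δ₁ δ₂ x)

/-! ### The Lyapunov assumption -/

/-- The Lyapunov assumption for the constants `δ = (δ₁, δ₂, δ₃)`, satisfied by `V` and `φ`. In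
`growth`, the bound on the remainder `g` is asked for `0 < ε ≤ ε₀`, with `ε₀` arbitrarily small (the
bound at `ε = 0` is its limit by continuity of `g`). -/
structure Lyapunov {n : ℕ} (f₁ f₂ : EuclideanSpace ℝ (Fin n) → ℝ → EuclideanSpace ℝ (Fin n))
    (T δ₁ δ₂ δ₃ : ℝ) (V φ : EuclideanSpace ℝ (Fin n) → ℝ) : Prop where
  contDiff : ContDiff ℝ 1 V
  nonneg : ∀ x, 0 ≤ V x
  posDef : PositiveDefinite φ
  bounds : ∃ α₁ α₂ : ℝ → ℝ, ClassKInf α₁ ∧ ClassKInf α₂ ∧ ∀ x, α₁ ‖x‖ ≤ V x ∧ V x ≤ α₂ ‖x‖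
  gradient_le : ∃ c₂ : ℝ, 0 < c₂ ∧ ∀ x, ‖gradient V x‖ ≤ c₂ * φ x
  decrease : ∃ c₁ : ℝ, 0 < c₁ ∧ ∀ x : EuclideanSpace ℝ (Fin n), δ₃ ≤ ‖x‖ →
    inner ℝ (gradient V x) (averagedField f₁ f₂ T δ₁ δ₂ x) ≤ -c₁ * φ x ^ 2
  growth :
    (∃ ε₀ L : ℝ, 0 < ε₀ ∧ 0 < L ∧ ∀ (x : EuclideanSpace ℝ (Fin n)) (τ ε : ℝ),
      δ₃ ≤ ‖x‖ → 0 ≤ τ → 0 < ε → ε ≤ ε₀ →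
        ‖remainder f₁ f₂ T δ₁ δ₂ x τ ε‖ ≤ L * (φ x + 1)) ∨
    (∃ α₃ : ℝ → ℝ, ClassK α₃ ∧ ∀ x, α₃ ‖x‖ * ‖x‖ ≤ φ x)

end SecondOrderAveraging

end

/-! Fix a scale `d` and truncate with radii `d`, `2 * d`, `5 * d`. In the coordinates y = Φ(x, τ)
the oscillation is removed to second order: the equation becomes ẏ = f̄(y) + ε g. Where ‖y‖ ≥ 5d,
the term ε⟨∇V, g⟩ is at most a multiple of ε φ(y)², so for small ε it costs at most half of the
guaranteed decay c φ(y)², and V(y) decreases (`exists_pushforward_bound`,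
`exists_lyapunov_estimate`). Hence V(y) is bounded by the larger of α₂(5d) and the flow of a scalar
equation v' = -ρ(v) (`le_max_clockFlow`). Since Φ is within relative distance 1/4 of the identity,
this bounds ‖x‖. Choosing `d` with α₂(5d) = α₁(ν/2) makes the residual ν.

The main difficulty is the order of quantifiers: β comes before ν, yet the truncation, f̄ and the
decay constant all depend on `d`. By `averagedField_congr`, f̄ does not depend on the truncation
outside the truncated ball. So -⟨∇V, f̄⟩ defines one function on the whole space, `dissipation`, and
`exists_rate` extracts from it one rate ρ that serves all scales. Only the threshold on ε depends on
`d`.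

Two points of regularity need care. First, D_x f₁ is not assumed continuous in τ; only D_x f₁ f₁ is
controlled, and only in x. The construction is therefore phrased through `selfDeriv`, the derivative
of the truncated field along itself, whose joint continuity is proved in `continuous_selfDeriv`.
Integration by parts in time, `FastField.fderiv_primitive_apply_primitive`, then shows that f̄ is
the mean of f̂₂ - D_x v₁ f̂₁ and that v₂ is the primitive of the corresponding mean-free field.

Second, the original field is merely continuous at the origin, so solutions need not be unique. The
estimates hold along every solution, and completeness of maximal solutions rests on a Peano theorem
(`exists_local_solution`) and a continuation argument (`exists_extension`). -/

set_option linter.unusedSectionVars false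

namespace SecondOrderAveraging

/-! ### Lipschitz estimates outside a ball -/

section LipschitzOutsideBall

variable {E E₁ E₂ F : Type*} [NormedAddCommGroup E] [NormedSpace ℝ E]
  [NormedAddCommGroup E₁] [NormedSpace ℝ E₁] [NormedAddCommGroup E₂] [NormedSpace ℝ E₂]
  [NormedAddCommGroup F] [NormedSpace ℝ F]

/-- Lipschitz continuity outside the open ball of radius `δ`. -/
def LipOutside (δ L : ℝ) (G : E → F) : Prop :=
  ∀ x y : E, δ ≤ ‖x‖ → δ ≤ ‖y‖ → ‖G x - G y‖ ≤ L * ‖x - y‖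

/-- The factor `G` may grow at infinity, so the product rule alone gives no Lipschitz bound. But `S`
is constant beyond radius δ₂. Splitting the increment so that `S x - S y` meets `G` at the point of
smaller norm, either that point lies in the annulus, where `G` is bounded, or both points lie beyond
δ₂ and the term vanishes. -/
theorem LipOutside.bilinear {δ₁ δ₂ C A L B : ℝ} (m : E₁ →L[ℝ] E₂ →L[ℝ] F) {S : E → E₁} {G : E → E₂}
    {s : E₁} (hC : 0 ≤ C) (hA : 0 ≤ A) (hB : 0 ≤ B)
    (hS : LipOutside δ₁ C S) (hSb : ∀ x, δ₁ ≤ ‖x‖ → ‖S x‖ ≤ A) (hs : ∀ x, δ₂ ≤ ‖x‖ → S x = s)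
    (hG : LipOutside δ₁ L G) (hGb : ∀ x, δ₁ ≤ ‖x‖ → ‖x‖ ≤ δ₂ → ‖G x‖ ≤ B) :
    LipOutside δ₁ (‖m‖ * (A * L + C * B)) (fun x => m (S x) (G x)) := by
  have key : ∀ x y : E, δ₁ ≤ ‖x‖ → δ₁ ≤ ‖y‖ → ‖y‖ ≤ ‖x‖ →
      ‖m (S x) (G x) - m (S y) (G y)‖ ≤ ‖m‖ * (A * L + C * B) * ‖x - y‖ := by
    intro x y hx hy hyx
    have e : m (S x) (G x) - m (S y) (G y) = m (S x) (G x - G y) + m (S x - S y) (G y) := by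
      simp only [map_sub, _root_.sub_apply]; abel
    have h1 : ‖m (S x) (G x - G y)‖ ≤ ‖m‖ * A * (L * ‖x - y‖) :=
      (m.le_opNorm₂ _ _).trans (mul_le_mul
        (mul_le_mul_of_nonneg_left (hSb x hx) (norm_nonneg m)) (hG x y hx hy) (norm_nonneg _)
        (by positivity))
    have h2 : ‖S x - S y‖ * ‖G y‖ ≤ C * ‖x - y‖ * B := by
      rcases le_total ‖y‖ δ₂ with h | h
      · exact mul_le_mul (hS x y hx hy) (hGb y hy h) (norm_nonneg _) (by positivity)
      · rw [hs x (h.trans hyx), hs y h, sub_self, norm_zero, zero_mul]; positivity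
    have h3 : ‖m (S x - S y) (G y)‖ ≤ ‖m‖ * (C * ‖x - y‖ * B) := by
      refine (m.le_opNorm₂ _ _).trans ?_
      rw [mul_assoc]
      exact mul_le_mul_of_nonneg_left h2 (norm_nonneg m)
    rw [e]
    refine (norm_add_le _ _).trans ((add_le_add h1 h3).trans (le_of_eq ?_))
    ring
  intro x y hx hy
  rcases le_total ‖y‖ ‖x‖ with h | h
  · exact key x y hx hy h
  · rw [norm_sub_rev, norm_sub_rev x y]; exact key y x hy hx h

theorem LipOutside.add {δ L L' : ℝ} {G H : E → F} (hG : LipOutside δ L G)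
    (hH : LipOutside δ L' H) : LipOutside δ (L + L') (fun x => G x + H x) := by
  intro x y hx hy
  have e : G x + H x - (G y + H y) = (G x - G y) + (H x - H y) := by abel
  rw [e, add_mul]
  exact (norm_add_le _ _).trans (add_le_add (hG x y hx hy) (hH x y hx hy))

theorem exists_norm_eq_of_mem_segment {δ : ℝ} {x y : E} (hy : ‖y‖ ≤ δ) (hx : δ ≤ ‖x‖) :
    ∃ z : E, ‖z‖ = δ ∧ ‖x - z‖ ≤ ‖x - y‖ := by
  have hc : ContinuousOn (fun t : ℝ => ‖y + t • (x - y)‖) (Icc 0 1) := by fun_prop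
  have := intermediate_value_Icc zero_le_one hc
  obtain ⟨t, ht, hz⟩ := this (show δ ∈ Icc _ _ by simpa using ⟨hy, hx⟩)
  refine ⟨_, hz, ?_⟩
  have e : x - (y + t • (x - y)) = (1 - t) • (x - y) := by module
  rw [e, norm_smul, Real.norm_eq_abs, abs_of_nonneg (by linarith [ht.2])]
  exact mul_le_of_le_one_left (norm_nonneg _) (by linarith [ht.1])

/-- The segment from an inner to an outer point crosses the sphere of radius δ, where `G` is already
zero; the crossing point replaces the inner one. -/
theorem LipOutside.global {δ L : ℝ} {G : E → F} (hL : 0 ≤ L) (hG : LipOutside δ L G)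
    (h0 : ∀ x, ‖x‖ ≤ δ → G x = 0) (x y : E) : ‖G x - G y‖ ≤ L * ‖x - y‖ := by
  have key : ∀ x y : E, δ ≤ ‖x‖ → ‖y‖ ≤ δ → ‖G x - G y‖ ≤ L * ‖x - y‖ := by
    intro x y hx hy
    obtain ⟨z, hz, hxz⟩ := exists_norm_eq_of_mem_segment hy hx
    rw [h0 y hy, ← h0 z hz.le]
    exact (hG x z hx hz.ge).trans (mul_le_mul_of_nonneg_left hxz hL)
  rcases le_total δ ‖x‖ with hx | hx <;> rcases le_total δ ‖y‖ with hy | hy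
  · exact hG x y hx hy
  · exact key x y hx hy
  · rw [norm_sub_rev, norm_sub_rev x y]; exact key y x hy hx
  · rw [h0 x hx, h0 y hy, sub_self, norm_zero]; positivity

/-- Multiplication by a Lipschitz cutoff turns Lipschitz continuity outside a ball into global
Lipschitz continuity. -/
theorem LipOutside.cutoff_smul {δ₁ δ₂ C L B : ℝ} {χ : E → ℝ} {G : E → F} (hC : 0 ≤ C) (hL : 0 ≤ L)
    (hB : 0 ≤ B) (hχ : ∀ x y, |χ x - χ y| ≤ C * ‖x - y‖) (hχ1 : ∀ x, |χ x| ≤ 1)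
    (hχ0 : ∀ x, ‖x‖ ≤ δ₁ → χ x = 0) (hχ2 : ∀ x, δ₂ ≤ ‖x‖ → χ x = 1)
    (hG : LipOutside δ₁ L G) (hGb : ∀ x, δ₁ ≤ ‖x‖ → ‖x‖ ≤ δ₂ → ‖G x‖ ≤ B) (x y : E) :
    ‖χ x • G x - χ y • G y‖ ≤ (L + C * B) * ‖x - y‖ := by
  have h1 := LipOutside.bilinear (δ₂ := δ₂) (s := 1)
    (ContinuousLinearMap.lsmul ℝ ℝ : ℝ →L[ℝ] F →L[ℝ] F) hC zero_le_one hB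
    (S := χ) (G := G) (fun x y _ _ => hχ x y) (fun x _ => hχ1 x) hχ2 hG hGb
  have h2 : LipOutside δ₁ (L + C * B) (fun x => χ x • G x) := by
    intro x y hx hy
    refine (h1 x y hx hy).trans (mul_le_mul_of_nonneg_right ?_ (norm_nonneg _))
    rw [one_mul]
    exact mul_le_of_le_one_left (by positivity) ContinuousLinearMap.opNorm_lsmul_le
  exact h2.global (by positivity) (fun x hx => by simp [hχ0 x hx]) x y

end LipschitzOutsideBall

/-! ### The bump function -/

section Bump

variable {n : ℕ} {δ₁ δ₂ : ℝ}

local notation "E" => EuclideanSpace ℝ (Fin n)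

theorem bump_eq_zero (h : δ₁ < δ₂) {x : E} (hx : ‖x‖ ≤ δ₁) : bump δ₁ δ₂ x = 0 := by
  rw [bump, if_pos h]
  exact Real.smoothTransition.zero_of_nonpos
    (div_nonpos_of_nonpos_of_nonneg (by linarith) (by linarith))

theorem bump_eq_one (h : δ₁ < δ₂) {x : E} (hx : δ₂ ≤ ‖x‖) : bump δ₁ δ₂ x = 1 := by
  rw [bump, if_pos h]
  exact Real.smoothTransition.one_of_one_le ((one_le_div (by linarith)).2 (by linarith))

theorem bump_nonneg (x : E) : 0 ≤ bump δ₁ δ₂ x := by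
  unfold bump; split_ifs
  exacts [Real.smoothTransition.nonneg _, zero_le_one]

theorem bump_le_one (x : E) : bump δ₁ δ₂ x ≤ 1 := by
  unfold bump; split_ifs
  exacts [Real.smoothTransition.le_one _, le_rfl]

theorem abs_bump_le_one (x : E) : |bump δ₁ δ₂ x| ≤ 1 := by
  rw [abs_of_nonneg (bump_nonneg x)]; exact bump_le_one x

/-- The norm fails to be smooth only at the origin, near which the bump vanishes because δ₁ is
positive. -/
theorem contDiff_bump (h₀ : 0 < δ₁) (h : δ₁ < δ₂) : ContDiff ℝ 2 (bump δ₁ δ₂ : E → ℝ) := by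
  rw [contDiff_iff_contDiffAt]
  intro x
  by_cases hx : x = 0
  · have : (bump δ₁ δ₂ : E → ℝ) =ᶠ[𝓝 x] fun _ => 0 := by
      filter_upwards [Metric.ball_mem_nhds x h₀] with y hy
      exact bump_eq_zero h (by simpa [hx] using (mem_ball_iff_norm.1 hy).le)
    exact contDiffAt_const.congr_of_eventuallyEq this
  · have e : (bump δ₁ δ₂ : E → ℝ) =
        fun x => Real.smoothTransition ((‖x‖ - δ₁) / (δ₂ - δ₁)) := by
      funext x; rw [bump, if_pos h]
    rw [e]
    exact (Real.smoothTransition.contDiff (n := 2)).contDiffAt.comp x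
      (((contDiffAt_norm ℝ hx).sub contDiffAt_const).div_const _)

/-- Such a point is a global maximum; this covers the boundary sphere as well. -/
theorem fderiv_bump_eq_zero_of_ge (h : δ₁ < δ₂) {x : E} (hx : δ₂ ≤ ‖x‖) :
    fderiv ℝ (bump δ₁ δ₂) x = 0 :=
  IsLocalMax.fderiv_eq_zero (Eventually.of_forall fun y => by
    rw [bump_eq_one h hx]; exact bump_le_one y)

theorem exists_fderiv_bump_bounds (h₀ : 0 < δ₁) (h : δ₁ < δ₂) :
    ∃ C : ℝ, 0 ≤ C ∧ (∀ x : E, ‖fderiv ℝ (bump δ₁ δ₂) x‖ ≤ C) ∧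
      (∀ x y : E, |bump δ₁ δ₂ x - bump δ₁ δ₂ y| ≤ C * ‖x - y‖) ∧
      ∀ x y : E, ‖fderiv ℝ (bump δ₁ δ₂) x - fderiv ℝ (bump δ₁ δ₂) y‖ ≤ C * ‖x - y‖ := by
  have hd : ContDiff ℝ 1 (fderiv ℝ (bump δ₁ δ₂ : E → ℝ)) :=
    (contDiff_bump h₀ h).fderiv_right (by norm_num)
  have hs : HasCompactSupport (fderiv ℝ (bump δ₁ δ₂ : E → ℝ)) :=
    HasCompactSupport.intro (isCompact_closedBall 0 δ₂) fun x hx =>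
      fderiv_bump_eq_zero_of_ge h (by simpa using (not_le.1 (by simpa using hx)).le)
  obtain ⟨C₁, hC₁⟩ := hs.exists_bound_of_continuous hd.continuous
  obtain ⟨C₂, hC₂⟩ := hd.lipschitzWith_of_hasCompactSupport hs one_ne_zero
  refine ⟨max C₁ C₂, le_max_of_le_right C₂.2, fun x => (hC₁ x).trans (le_max_left _ _),
    fun x y => ?_, fun x y => ?_⟩
  · refine (Convex.norm_image_sub_le_of_norm_fderiv_le (s := univ) (𝕜 := ℝ)
      (fun z _ => (contDiff_bump h₀ h).differentiable (by norm_num) z)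
      (fun z _ => hC₁ z) convex_univ (mem_univ y) (mem_univ x)).trans ?_
    exact mul_le_mul_of_nonneg_right (le_max_left _ _) (norm_nonneg _)
  · rw [← dist_eq_norm, ← dist_eq_norm]
    exact (hC₂.dist_le_mul x y).trans (mul_le_mul_of_nonneg_right (le_max_right _ _) dist_nonneg)

end Bump

/-! ### The truncated fields -/

/-- A field that is continuous, and for `τ ≥ 0` uniformly Lipschitz and differentiable in `x`,
`T`-periodic in `τ` and zero at the origin. -/
structure TameField {E : Type*} [NormedAddCommGroup E] [NormedSpace ℝ E] (T L : ℝ)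
    (h : E → ℝ → E) : Prop where
  nonneg : 0 ≤ L
  period_pos : 0 < T
  continuous : Continuous fun p : E × ℝ => h p.1 p.2
  lipschitz : ∀ τ, 0 ≤ τ → ∀ x y, ‖h x τ - h y τ‖ ≤ L * ‖x - y‖
  differentiable : ∀ τ, 0 ≤ τ → Differentiable ℝ fun x => h x τ
  periodic : ∀ x τ, 0 ≤ τ → h x (τ + T) = h x τ
  map_zero : ∀ τ, 0 ≤ τ → h 0 τ = 0

/-- Periodicity is available for nonnegative times only, so the reduction to one period is done by
hand. The codomain is arbitrary so that a single time can serve all x at once. -/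
theorem exists_mem_Ico_eq_of_periodic {X : Type*} {g : ℝ → X} {T : ℝ} (hT : 0 < T)
    (hg : ∀ τ, 0 ≤ τ → g (τ + T) = g τ) {τ : ℝ} (hτ : 0 ≤ τ) : ∃ s ∈ Ico 0 T, g τ = g s := by
  have key : ∀ (k : ℕ) (s : ℝ), 0 ≤ s → g (s + k * T) = g s := by
    intro k
    induction k with
    | zero => simp
    | succ k ih =>
      intro s hs
      rw [← ih s hs, ← hg (s + k * T) (by positivity)]
      congr 1; push_cast; ring
  refine ⟨τ - ⌊τ / T⌋₊ * T, ⟨?_, ?_⟩, ?_⟩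
  · have := Nat.floor_le (div_nonneg hτ hT.le)
    rw [le_div_iff₀ hT] at this; linarith
  · have := Nat.lt_floor_add_one (τ / T)
    rw [div_lt_iff₀ hT] at this; linarith
  · rw [← key ⌊τ / T⌋₊ (τ - ⌊τ / T⌋₊ * T)]
    · congr 1; ring
    · have := Nat.floor_le (div_nonneg hτ hT.le)
      rw [le_div_iff₀ hT] at this; linarith

/-- The directional derivative `D_x h(x, s) h(x, r)`. -/
noncomputable def selfDeriv {E : Type*} [NormedAddCommGroup E] [NormedSpace ℝ E] (h : E → ℝ → E) (x : E)
    (s r : ℝ) : E :=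
  fderiv ℝ (fun y => h y s) x (h x r)

section Truncation

variable {n : ℕ} {δ₁ δ₂ T : ℝ}

local notation "E" => EuclideanSpace ℝ (Fin n)

/-- The truncated field `f̂`, extended to negative `τ` by its value at `τ = 0`. -/
noncomputable def truncated (δ₁ δ₂ : ℝ) (f : E → ℝ → E) (x : E) (τ : ℝ) : E := cutoff δ₁ δ₂ f x (max τ 0)

theorem truncated_of_nonneg {f : E → ℝ → E} {x : E} {τ : ℝ} (hτ : 0 ≤ τ) :
    truncated δ₁ δ₂ f x τ = cutoff δ₁ δ₂ f x τ := by rw [truncated, max_eq_left hτ]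

theorem contDiff_bump_smul {k : ℕ∞} (h₀ : 0 < δ₁) (h : δ₁ < δ₂) (hk : (k : WithTop ℕ∞) ≤ 2)
    {G : E → E} {U : Set E} (hU : IsOpen U) (hUs : {x | δ₁ ≤ ‖x‖} ⊆ U)
    (hG : ContDiffOn ℝ k G U) : ContDiff ℝ k (fun x => bump δ₁ δ₂ x • G x) := by
  rw [contDiff_iff_contDiffAt]
  intro x
  rcases le_or_gt δ₁ ‖x‖ with hx | hx
  · exact ((contDiff_bump h₀ h).of_le hk).contDiffAt.smul (hG.contDiffAt (hU.mem_nhds (hUs hx)))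
  · have : (fun x => bump δ₁ δ₂ x • G x) =ᶠ[𝓝 x] fun _ => 0 := by
      filter_upwards [(isOpen_lt continuous_norm continuous_const).mem_nhds hx] with y hy
      rw [bump_eq_zero h (le_of_lt hy), zero_smul]
    exact contDiffAt_const.congr_of_eventuallyEq this

theorem exists_bound_of_periodic (hT : 0 < T) {f : E → ℝ → E}
    (hf : ContinuousOn (fun p : E × ℝ => f p.1 p.2) (univ ×ˢ Ici 0))
    (hp : ∀ x τ, 0 ≤ τ → f x (τ + T) = f x τ) (R : ℝ) :
    ∃ B : ℝ, 0 ≤ B ∧ ∀ x τ, ‖x‖ ≤ R → 0 ≤ τ → ‖f x τ‖ ≤ B := by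
  obtain ⟨B, hB⟩ := ((isCompact_closedBall (0 : E) R).prod (isCompact_Icc (a := 0) (b := T))
    ).exists_bound_of_continuousOn (hf.mono (prod_mono (subset_univ _) Icc_subset_Ici_self))
  refine ⟨max B 0, le_max_right _ _, fun x τ hx hτ => ?_⟩
  obtain ⟨s, hs, e⟩ := exists_mem_Ico_eq_of_periodic (g := fun τ x => f x τ) hT
    (fun τ hτ => funext fun x => hp x τ hτ) hτ
  rw [congrFun e x]
  exact (hB (x, s) ⟨by simpa using hx, hs.1, hs.2.le⟩).trans (le_max_left _ _)

theorem continuous_truncated (h₀ : 0 < δ₁) (h : δ₁ < δ₂) {f : E → ℝ → E}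
    (hf : ContinuousOn (fun p : E × ℝ => f p.1 p.2) (univ ×ˢ Ici 0)) :
    Continuous fun p : E × ℝ => truncated δ₁ δ₂ f p.1 p.2 := by
  have h1 : Continuous fun p : E × ℝ => f p.1 (max p.2 0) :=
    hf.comp_continuous (f := fun p : E × ℝ => (p.1, max p.2 0)) (by fun_prop)
      fun p => ⟨mem_univ _, mem_Ici.2 (le_max_right _ _)⟩
  exact ((contDiff_bump h₀ h).continuous.comp continuous_fst).smul h1

theorem exists_tameField_truncated (h₀ : 0 < δ₁) (h : δ₁ < δ₂) (hT : 0 < T) {f : E → ℝ → E}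
    (hf : ContinuousOn (fun p : E × ℝ => f p.1 p.2) (univ ×ˢ Ici 0))
    (hp : ∀ x τ, 0 ≤ τ → f x (τ + T) = f x τ)
    (hL : ∃ L : ℝ, 0 < L ∧ ∀ x y : E, δ₁ ≤ ‖x‖ → δ₁ ≤ ‖y‖ →
      ∀ τ : ℝ, 0 ≤ τ → ‖f x τ - f y τ‖ ≤ L * ‖x - y‖)
    (hd : ∀ τ : ℝ, 0 ≤ τ → ∃ U : Set E,
      IsOpen U ∧ {x | δ₁ ≤ ‖x‖} ⊆ U ∧ ContDiffOn ℝ 1 (fun x => f x τ) U) :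
    ∃ L, TameField T L (truncated δ₁ δ₂ f) := by
  obtain ⟨L, hL0, hL⟩ := hL
  obtain ⟨B, hB0, hB⟩ := exists_bound_of_periodic hT hf hp δ₂
  obtain ⟨C, hC0, -, hC, -⟩ := exists_fderiv_bump_bounds (n := n) h₀ h
  refine ⟨L + C * B, by positivity, hT, continuous_truncated h₀ h hf, fun τ hτ x y => ?_,
    fun τ hτ => ?_, fun x τ hτ => ?_, fun τ _ => ?_⟩
  · rw [truncated_of_nonneg hτ, truncated_of_nonneg hτ]
    exact LipOutside.cutoff_smul hC0 hL0.le hB0 hC abs_bump_le_one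
      (fun x hx => bump_eq_zero h hx) (fun x hx => bump_eq_one h hx)
      (fun x y hx hy => hL x y hx hy τ hτ) (fun x _ hx => hB x τ hx hτ) x y
  · obtain ⟨U, hU, hUs, hG⟩ := hd τ hτ
    have := contDiff_bump_smul (k := 1) h₀ h (by norm_num) hU hUs hG
    simp only [truncated_of_nonneg hτ]
    exact this.differentiable one_ne_zero
  · rw [truncated_of_nonneg hτ, truncated_of_nonneg (add_nonneg hτ hT.le), cutoff, cutoff,
      hp x τ hτ]
  · rw [truncated, cutoff, bump_eq_zero h (by simpa using h₀.le), zero_smul]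

/-- The product rule, with one cutoff factor pulled out in front: this is the shape to which
`LipOutside.cutoff_smul` applies. -/
theorem selfDeriv_truncated (h₀ : 0 < δ₁) (h : δ₁ < δ₂) {f : E → ℝ → E} (x : E) (s r : ℝ)
    (hd : ∀ τ, 0 ≤ τ → ∀ x, δ₁ ≤ ‖x‖ → DifferentiableAt ℝ (fun x => f x τ) x) :
    selfDeriv (truncated δ₁ δ₂ f) x s r = bump δ₁ δ₂ x •
      (bump δ₁ δ₂ x • fderiv ℝ (fun y => f y (max s 0)) x (f x (max r 0)) +
        fderiv ℝ (bump δ₁ δ₂) x (f x (max r 0)) • f x (max s 0)) := by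
  rcases lt_or_ge ‖x‖ δ₁ with hx | hx
  · simp [selfDeriv, truncated, cutoff, bump_eq_zero h hx.le]
  · have h1 : HasFDerivAt (bump δ₁ δ₂ : E → ℝ) (fderiv ℝ (bump δ₁ δ₂) x) x :=
      ((contDiff_bump h₀ h).differentiable (by norm_num) x).hasFDerivAt
    have h2 := (hd (max s 0) (le_max_right _ _) x hx).hasFDerivAt
    have h3 := (h1.smul h2).fderiv
    have h4 : fderiv ℝ (fun y => truncated δ₁ δ₂ f y s) x = _ := h3
    rw [selfDeriv, h4, truncated, cutoff, map_smul]
    simp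

/-- The self-derivative of the truncated field is globally Lipschitz in `x`. -/
theorem exists_lipschitz_selfDeriv_truncated (h₀ : 0 < δ₁) (h : δ₁ < δ₂) (hT : 0 < T)
    {f : E → ℝ → E}
    (hf : ContinuousOn (fun p : E × ℝ => f p.1 p.2) (univ ×ˢ Ici 0))
    (hp : ∀ x τ, 0 ≤ τ → f x (τ + T) = f x τ)
    {L : ℝ} (hL0 : 0 ≤ L) (hL : ∀ x y : E, δ₁ / 2 ≤ ‖x‖ → δ₁ / 2 ≤ ‖y‖ →
      ∀ τ : ℝ, 0 ≤ τ → ‖f x τ - f y τ‖ ≤ L * ‖x - y‖)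
    (hd : ∀ τ, 0 ≤ τ → ∀ x, δ₁ ≤ ‖x‖ → DifferentiableAt ℝ (fun x => f x τ) x)
    {L₃ : ℝ} (hL30 : 0 ≤ L₃) (hL3 : ∀ x y : E, δ₁ ≤ ‖x‖ → δ₁ ≤ ‖y‖ →
      ∀ τ₁ τ₂ : ℝ, 0 ≤ τ₁ → 0 ≤ τ₂ →
      ‖fderiv ℝ (fun z => f z τ₁) x (f x τ₂) - fderiv ℝ (fun z => f z τ₁) y (f y τ₂)‖
        ≤ L₃ * ‖x - y‖) :
    ∃ LK : ℝ, 0 ≤ LK ∧ ∀ s r x y,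
      ‖selfDeriv (truncated δ₁ δ₂ f) x s r - selfDeriv (truncated δ₁ δ₂ f) y s r‖
        ≤ LK * ‖x - y‖ := by
  obtain ⟨B, hB0, hB⟩ := exists_bound_of_periodic hT hf hp δ₂
  obtain ⟨C, hC0, hCb, hC, hC'⟩ := exists_fderiv_bump_bounds (n := n) h₀ h
  set m : ℝ →L[ℝ] E →L[ℝ] E := ContinuousLinearMap.lsmul ℝ ℝ with hm
  set j : (E →L[ℝ] ℝ) →L[ℝ] E →L[ℝ] ℝ := ContinuousLinearMap.id ℝ _ with hj
  -- A derivative bound needs the Lipschitz estimate on a full neighbourhood, also at points with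
  -- ‖x‖ = δ₁; hence the hypothesis at radius δ₁ / 2.
  have hDf : ∀ τ, 0 ≤ τ → ∀ x, δ₁ ≤ ‖x‖ → ‖fderiv ℝ (fun y => f y τ) x‖ ≤ L := by
    intro τ hτ x hx
    refine norm_fderiv_le_of_lip' ℝ hL0 ?_
    filter_upwards [(isOpen_lt continuous_const continuous_norm).mem_nhds
      (show δ₁ / 2 < ‖x‖ by linarith)] with y hy
    exact hL y x (le_of_lt hy) (by linarith) τ hτ
  -- The Lipschitz constant is left open and read off from the estimates, which are therefore proved
  -- first.
  refine ⟨?_, ?_, fun s r x y => ?_⟩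
  rotate_left 2
  · rw [selfDeriv_truncated h₀ h x s r hd, selfDeriv_truncated h₀ h y s r hd]
    have hs : 0 ≤ max s 0 := le_max_right _ _
    have hr : 0 ≤ max r 0 := le_max_right _ _
    have hf' : ∀ τ, 0 ≤ τ → LipOutside δ₁ L (fun x => f x τ) := fun τ hτ x y hx hy =>
      hL x y (by linarith) (by linarith) τ hτ
    have hMb : ∀ x, δ₁ ≤ ‖x‖ → ‖x‖ ≤ δ₂ →
        ‖fderiv ℝ (fun y => f y (max s 0)) x (f x (max r 0))‖ ≤ L * B := fun x hx hx' =>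
      (ContinuousLinearMap.le_opNorm _ _).trans
        (mul_le_mul (hDf _ hs x hx) (hB x _ hx' hr) (norm_nonneg _) hL0)
    have h1 := LipOutside.bilinear (δ₂ := δ₂) (s := 1) m hC0 zero_le_one
      (mul_nonneg hL0 hB0) (S := bump δ₁ δ₂)
      (G := fun x => fderiv ℝ (fun y => f y (max s 0)) x (f x (max r 0)))
      (fun x y _ _ => hC x y) (fun x _ => abs_bump_le_one x) (fun x hx => bump_eq_one h hx)
      (fun x y hx hy => hL3 x y hx hy _ _ hs hr) hMb
    have h2 := LipOutside.bilinear (δ₂ := δ₂) (s := 0) j hC0 hC0 hB0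
      (S := fderiv ℝ (bump δ₁ δ₂)) (G := fun x => f x (max r 0))
      (fun x y _ _ => hC' x y) (fun x _ => hCb x) (fun x hx => fderiv_bump_eq_zero_of_ge h hx)
      (hf' _ hr) (fun x _ hx => hB x _ hx hr)
    have hb2 : ∀ x, ‖x‖ ≤ δ₂ → ‖fderiv ℝ (bump δ₁ δ₂) x (f x (max r 0))‖ ≤ C * B := fun x hx =>
      (ContinuousLinearMap.le_opNorm _ _).trans
        (mul_le_mul (hCb x) (hB x _ hx hr) (norm_nonneg _) hC0)
    have h3 := LipOutside.bilinear (δ₂ := δ₂) (s := 0) m (C := ‖j‖ * (C * L + C * B)) (A := C * B)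
      (by positivity) (by positivity) hB0
      (S := fun x => fderiv ℝ (bump δ₁ δ₂) x (f x (max r 0))) (G := fun x => f x (max s 0))
      h2 (fun x _ => by
        rcases le_total ‖x‖ δ₂ with hx | hx
        · exact hb2 x hx
        · rw [fderiv_bump_eq_zero_of_ge h hx]; simp; positivity)
      (fun x hx => by simp [fderiv_bump_eq_zero_of_ge h hx]) (hf' _ hs) (fun x _ hx => hB x _ hx hs)
    refine LipOutside.cutoff_smul (B := L * B + C * B * B) hC0 ?_ ?_ hC abs_bump_le_one
      (fun x hx => bump_eq_zero h hx) (fun x hx => bump_eq_one h hx) (h1.add h3) ?_ x y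
    · positivity
    · positivity
    · intro x hx hx'
      refine (norm_add_le _ _).trans (add_le_add ?_ ?_)
      · change ‖bump δ₁ δ₂ x • (fderiv ℝ (fun y => f y (max s 0)) x (f x (max r 0)))‖ ≤ _
        rw [norm_smul]
        exact (mul_le_of_le_one_left (norm_nonneg _) (abs_bump_le_one x)).trans (hMb x hx hx')
      · change ‖(fderiv ℝ (bump δ₁ δ₂) x (f x (max r 0))) • f x (max s 0)‖ ≤ _
        rw [norm_smul]
        exact mul_le_mul (hb2 x hx') (hB x _ hx' hs) (norm_nonneg _) (by positivity)
  · positivity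

end Truncation

/-! ### Joint continuity of the self-derivative -/

section SelfDeriv

variable {E : Type*} [NormedAddCommGroup E] [NormedSpace ℝ E] {a : E → ℝ → E}

/-- A first-order Taylor estimate in the direction of the field itself, with a quadratic error that
is uniform in the two times and locally uniform in x wherever `a x r` is bounded. It is the source
of the uniform convergence in `continuous_selfDeriv`. -/
theorem norm_sub_smul_selfDeriv_le {L LK : ℝ} (hL0 : 0 ≤ L) (hLK0 : 0 ≤ LK)
    (hd : ∀ τ, Differentiable ℝ fun x => a x τ)
    (hL : ∀ τ x y, ‖a x τ - a y τ‖ ≤ L * ‖x - y‖)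
    (hLK : ∀ s r x y, ‖selfDeriv a x s r - selfDeriv a y s r‖ ≤ LK * ‖x - y‖)
    (x : E) (s r : ℝ) {η : ℝ} (hη : 0 ≤ η) :
    ‖a (x + η • a x r) s - a x s - η • selfDeriv a x s r‖
      ≤ (LK + L * L) * ‖a x r‖ * η * η := by
  set u := a x r with hu
  have hD : ∀ y, ‖fderiv ℝ (fun z => a z s) y‖ ≤ L := fun y =>
    norm_fderiv_le_of_lip' ℝ hL0 (Eventually.of_forall fun z => hL s z y)
  set g : ℝ → E := fun θ => a (x + θ • u) s - a x s - θ • selfDeriv a x s r with hg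
  have hg' : ∀ θ ∈ Icc 0 η, HasDerivWithinAt g
      (fderiv ℝ (fun z => a z s) (x + θ • u) u - selfDeriv a x s r) (Icc 0 η) θ := by
    intro θ _
    have h1 : HasDerivAt (fun θ : ℝ => x + θ • u) u θ := by
      simpa using ((hasDerivAt_id θ).smul_const u).const_add x
    have h2 := ((hd s) (x + θ • u)).hasFDerivAt.comp_hasDerivAt θ h1
    have h3 : HasDerivAt (fun θ : ℝ => θ • selfDeriv a x s r) (selfDeriv a x s r) θ := by
      simpa using (hasDerivAt_id θ).smul_const (selfDeriv a x s r)
    exact ((h2.sub_const (a x s)).sub h3).hasDerivWithinAt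
  have hb : ∀ θ ∈ Ico 0 η, ‖fderiv ℝ (fun z => a z s) (x + θ • u) u - selfDeriv a x s r‖
      ≤ (LK + L * L) * ‖u‖ * η := by
    intro θ hθ
    -- Since `fderiv` is not known to be Lipschitz, the frozen direction `u` is exchanged for the
    -- field at the moving point: the first bracket is then an increment of `selfDeriv`, and the
    -- second uses only the bound on the derivative.
    have e : fderiv ℝ (fun z => a z s) (x + θ • u) u - selfDeriv a x s r =
        (selfDeriv a (x + θ • u) s r - selfDeriv a x s r) +
          fderiv ℝ (fun z => a z s) (x + θ • u) (a x r - a (x + θ • u) r) := by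
      rw [map_sub]; simp only [selfDeriv, ← hu]; abel
    have e2 : ‖x + θ • u - x‖ = θ * ‖u‖ := by
      rw [add_sub_cancel_left, norm_smul, Real.norm_eq_abs, abs_of_nonneg hθ.1]
    have h1 := hLK s r (x + θ • u) x
    have h2 := hL r (x + θ • u) x
    rw [e2] at h1 h2
    have h3 : ‖fderiv ℝ (fun z => a z s) (x + θ • u) (a x r - a (x + θ • u) r)‖
        ≤ L * (L * (θ * ‖u‖)) :=
      (ContinuousLinearMap.le_opNorm _ _).trans
        (mul_le_mul (hD _) (by rwa [norm_sub_rev]) (norm_nonneg _) hL0)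
    rw [e]
    refine (norm_add_le _ _).trans ((add_le_add h1 h3).trans ?_)
    have : θ * ((LK + L * L) * ‖u‖) ≤ η * ((LK + L * L) * ‖u‖) :=
      mul_le_mul_of_nonneg_right hθ.2.le (by positivity)
    linarith
  have := norm_image_sub_le_of_norm_deriv_le_segment' hg' hb η (right_mem_Icc.2 hη)
  simpa [hg] using this

/-- No continuity of D_x a in time is assumed. But `selfDeriv` is the locally uniform limit of the
difference quotients of `a` along `a`, and these are jointly continuous. -/
theorem continuous_selfDeriv {L LK : ℝ} (hL0 : 0 ≤ L) (hLK0 : 0 ≤ LK)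
    (hc : Continuous fun p : E × ℝ => a p.1 p.2) (hd : ∀ τ, Differentiable ℝ fun x => a x τ)
    (hL : ∀ τ x y, ‖a x τ - a y τ‖ ≤ L * ‖x - y‖)
    (hLK : ∀ s r x y, ‖selfDeriv a x s r - selfDeriv a y s r‖ ≤ LK * ‖x - y‖) :
    Continuous fun p : E × ℝ × ℝ => selfDeriv a p.1 p.2.1 p.2.2 := by
  have hc' : ∀ {X : Type _} [TopologicalSpace X] {u : X → E} {v : X → ℝ}, Continuous u →
      Continuous v → Continuous fun p => a (u p) (v p) := fun hu hv =>
    hc.comp (hu.prodMk hv)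
  set S : ℝ → E × ℝ × ℝ → E := fun η p =>
    η⁻¹ • (a (p.1 + η • a p.1 p.2.2) p.2.1 - a p.1 p.2.1) with hS
  have hlim : TendstoLocallyUniformly S (fun p => selfDeriv a p.1 p.2.1 p.2.2) (𝓝[>] (0 : ℝ)) := by
    rw [Metric.tendstoLocallyUniformly_iff]
    intro e he p₀
    have hcn : Continuous fun p : E × ℝ × ℝ => ‖a p.1 p.2.2‖ :=
      (hc' continuous_fst (continuous_snd.comp continuous_snd)).norm
    set C := (LK + L * L) * (‖a p₀.1 p₀.2.2‖ + 1) + 1 with hC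
    have hC0 : 0 < C := by positivity
    refine ⟨{p | ‖a p.1 p.2.2‖ < ‖a p₀.1 p₀.2.2‖ + 1},
      (isOpen_lt hcn continuous_const).mem_nhds (by simp), ?_⟩
    filter_upwards [Ioo_mem_nhdsGT (show (0 : ℝ) < e / C by positivity)] with η hη p hp
    have h1 := norm_sub_smul_selfDeriv_le hL0 hLK0 hd hL hLK p.1 p.2.1 p.2.2 hη.1.le
    have e1 : S η p - selfDeriv a p.1 p.2.1 p.2.2 = η⁻¹ •
        (a (p.1 + η • a p.1 p.2.2) p.2.1 - a p.1 p.2.1 - η • selfDeriv a p.1 p.2.1 p.2.2) := by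
      simp only [hS, smul_sub, smul_smul, inv_mul_cancel₀ hη.1.ne', one_smul]
    rw [dist_comm, dist_eq_norm, e1, norm_smul, norm_inv, Real.norm_eq_abs, abs_of_pos hη.1,
      inv_mul_lt_iff₀ hη.1]
    refine h1.trans_lt ?_
    have h2 : (LK + L * L) * ‖a p.1 p.2.2‖ ≤ C - 1 := by
      rw [hC, add_sub_cancel_right]
      exact mul_le_mul_of_nonneg_left (le_of_lt hp) (by positivity)
    have h3 : C * η < e := by rw [mul_comm]; exact (lt_div_iff₀ hC0).1 hη.2
    have h4 : (LK + L * L) * ‖a p.1 p.2.2‖ * η ≤ (C - 1) * η :=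
      mul_le_mul_of_nonneg_right h2 hη.1.le
    have h5 : (LK + L * L) * ‖a p.1 p.2.2‖ * η < e := by linarith [hη.1]
    rw [mul_comm η e]
    exact mul_lt_mul_of_pos_right h5 hη.1
  refine hlim.continuous (Eventually.frequently (Eventually.of_forall fun η => ?_))
  refine ((hc' (continuous_fst.add ((hc' continuous_fst
    (continuous_snd.comp continuous_snd)).const_smul η)) (continuous_fst.comp continuous_snd)).sub
    (hc' continuous_fst (continuous_fst.comp continuous_snd))).const_smul _

end SelfDeriv

/-! ### Primitives of oscillating fields -/

section Primitive

variable {n : ℕ} {T L : ℝ}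

local notation "E" => EuclideanSpace ℝ (Fin n)

/-- The primitive in time of a time-dependent field. -/
noncomputable def primitive (h : E → ℝ → E) (x : E) (τ : ℝ) : E := ∫ s in (0 : ℝ)..τ, h x s

theorem continuous_section {h : E → ℝ → E} (hc : Continuous fun p : E × ℝ => h p.1 p.2) (x : E) :
    Continuous (h x) := hc.comp (Continuous.prodMk_right x)

/-- Differentiation under the integral, dominated by the Lipschitz constant. The integrand D_x h is
only known to be measurable in time, which suffices. -/
theorem hasFDerivAt_primitive {h : E → ℝ → E} (hc : Continuous fun p : E × ℝ => h p.1 p.2)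
    (hL : ∀ τ, 0 ≤ τ → ∀ x y, ‖h x τ - h y τ‖ ≤ L * ‖x - y‖) (hL0 : 0 ≤ L)
    (hd : ∀ τ, 0 ≤ τ → Differentiable ℝ fun x => h x τ) (x : E) {τ : ℝ} (hτ : 0 ≤ τ) :
    IntervalIntegrable (fun s => fderiv ℝ (fun y => h y s) x) volume 0 τ ∧
      HasFDerivAt (fun y => primitive h y τ) (∫ s in (0 : ℝ)..τ, fderiv ℝ (fun y => h y s) x) x := by
  refine intervalIntegral.hasFDerivAt_integral_of_dominated_loc_of_lip (s := univ)
    (bound := fun _ => L) univ_mem ?_ ?_ ?_ ?_ ?_ ?_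
  · exact Eventually.of_forall fun y => (continuous_section hc y).aestronglyMeasurable
  · exact (continuous_section hc x).intervalIntegrable _ _
  · have h1 : Measurable fun p : ℝ × E => fderiv ℝ (fun y => h y p.1) p.2 :=
      measurable_fderiv_with_param ℝ (f := fun (s : ℝ) (y : E) => h y s)
        (hc.comp continuous_swap)
    exact (h1.comp (measurable_id.prodMk measurable_const)).aestronglyMeasurable
  · refine Eventually.of_forall fun s hs => ?_
    rw [uIoc_of_le hτ] at hs
    refine LipschitzOnWith.of_dist_le_mul fun y _ z _ => ?_
    rw [dist_eq_norm, dist_eq_norm, Real.coe_nnabs, abs_of_nonneg hL0]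
    exact hL s hs.1.le y z
  · exact intervalIntegrable_const
  · refine Eventually.of_forall fun s hs => ?_
    rw [uIoc_of_le hτ] at hs
    exact (hd s hs.1.le x).hasFDerivAt

theorem continuous_primitive {h : E → ℝ → E} (hc : Continuous fun p : E × ℝ => h p.1 p.2) :
    Continuous fun p : E × ℝ => primitive h p.1 p.2 :=
  intervalIntegral.continuous_parametric_intervalIntegral_of_continuous
    (f := fun (p : E × ℝ) s => h p.1 s)
    (hc.comp ((continuous_fst.comp continuous_fst).prodMk continuous_snd)) continuous_snd

theorem norm_primitive_sub_le {h : E → ℝ → E} (hc : Continuous fun p : E × ℝ => h p.1 p.2)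
    (hL : ∀ τ, 0 ≤ τ → ∀ x y, ‖h x τ - h y τ‖ ≤ L * ‖x - y‖) (x y : E) {τ : ℝ} (hτ : 0 ≤ τ) :
    ‖primitive h x τ - primitive h y τ‖ ≤ τ * L * ‖x - y‖ := by
  rw [primitive, primitive, ← intervalIntegral.integral_sub
    ((continuous_section hc x).intervalIntegrable _ _)
    ((continuous_section hc y).intervalIntegrable _ _)]
  refine (intervalIntegral.norm_integral_le_of_norm_le_const
    (C := L * ‖x - y‖) fun s hs => ?_).trans (le_of_eq ?_)
  · rw [uIoc_of_le hτ] at hs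
    exact hL s hs.1.le x y
  · rw [sub_zero, abs_of_nonneg hτ]; ring

theorem hasDerivAt_primitive {h : E → ℝ → E} (hc : Continuous fun p : E × ℝ => h p.1 p.2)
    (x : E) (τ : ℝ) : HasDerivAt (primitive h x) (h x τ) τ :=
  intervalIntegral.integral_hasDerivAt_right ((continuous_section hc x).intervalIntegrable _ _)
    (continuous_section hc x).stronglyMeasurable.stronglyMeasurableAtFilter
    (continuous_section hc x).continuousAt

/-- The chain rule for a primitive along a curve. -/
theorem hasDerivWithinAt_primitive_comp {h : E → ℝ → E}
    (hc : Continuous fun p : E × ℝ => h p.1 p.2)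
    (hL : ∀ τ, 0 ≤ τ → ∀ x y, ‖h x τ - h y τ‖ ≤ L * ‖x - y‖) (hL0 : 0 ≤ L)
    (hd : ∀ τ, 0 ≤ τ → Differentiable ℝ fun x => h x τ)
    {x : ℝ → E} {τ : ℝ → ℝ} {S : Set ℝ} {t : ℝ} (ht : t ∈ S) (hτ : ∀ t ∈ S, 0 ≤ τ t)
    {x' : E} {τ' : ℝ} (hx : HasDerivWithinAt x x' S t) (hτ' : HasDerivWithinAt τ τ' S t) :
    HasDerivWithinAt (fun t => primitive h (x t) (τ t))
      (fderiv ℝ (fun y => primitive h y (τ t)) (x t) x' + τ' • h (x t) (τ t)) S t := by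
  have hi : ∀ y a b, IntervalIntegrable (h y) volume a b := fun y a b =>
    (continuous_section hc y).intervalIntegrable _ _
  have h1 : HasDerivWithinAt (fun r => primitive h (x r) (τ t))
      (fderiv ℝ (fun y => primitive h y (τ t)) (x t) x') S t := by
    have := (hasFDerivAt_primitive hc hL hL0 hd (x t) (hτ t ht)).2.differentiableAt.hasFDerivAt
    exact this.comp_hasDerivWithinAt t hx
  have h2 : HasDerivWithinAt (fun r => primitive h (x t) (τ r)) (τ' • h (x t) (τ t)) S t :=
    (hasDerivAt_primitive hc (x t) (τ t)).scomp_hasDerivWithinAt t hτ'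
  -- The primitive is not known to be jointly C¹, so the usual chain rule is unavailable. `R` is the
  -- mixed second difference left after varying x and τ separately; it is bounded by L ‖x r - x t‖
  -- |τ r - τ t|, hence is o(r - t).
  set R : ℝ → E := fun r => ∫ s in (τ t)..(τ r), (h (x r) s - h (x t) s) with hR
  have h3 : HasDerivWithinAt R 0 S t := by
    have hRt : R t = 0 := by simp [hR]
    rw [hasDerivWithinAt_iff_isLittleO]
    simp only [hRt, sub_zero, smul_zero]
    have hb : R =O[𝓝[S] t] fun r => ‖x r - x t‖ * (τ r - τ t) := by
      refine Asymptotics.IsBigO.of_bound L ?_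
      filter_upwards [self_mem_nhdsWithin] with r hr
      refine (intervalIntegral.norm_integral_le_of_norm_le_const
        (C := L * ‖x r - x t‖) fun s hs => ?_).trans (le_of_eq ?_)
      · have : 0 ≤ s := (le_min (hτ t ht) (hτ r hr)).trans (by
          rw [uIoc] at hs; exact hs.1.le)
        exact hL s this _ _
      · rw [norm_mul, norm_norm, Real.norm_eq_abs]; ring
    refine hb.trans_isLittleO ?_
    have h4 : (fun r => ‖x r - x t‖) =o[𝓝[S] t] fun _ => (1 : ℝ) := by
      rw [Asymptotics.isLittleO_one_iff]
      have : Tendsto (fun r => x r - x t) (𝓝[S] t) (𝓝 (x t - x t)) :=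
        hx.continuousWithinAt.tendsto.sub_const (x t)
      simpa using this.norm
    simpa using h4.mul_isBigO hτ'.differentiableWithinAt.isBigO_sub
  have h4 := (h1.add h2).add h3
  rw [add_zero] at h4
  have h5 := h4.sub_const (primitive h (x t) (τ t))
  refine h5.congr_of_mem (fun r hr => ?_) ht
  have e1 : R r = (primitive h (x r) (τ r) - primitive h (x r) (τ t)) -
      (primitive h (x t) (τ r) - primitive h (x t) (τ t)) := by
    rw [hR]
    simp only [primitive]
    rw [intervalIntegral.integral_sub (hi _ _ _) (hi _ _ _),
      intervalIntegral.integral_interval_sub_left (hi _ _ _) (hi _ _ _),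
      intervalIntegral.integral_interval_sub_left (hi _ _ _) (hi _ _ _)]
  simp only [Pi.add_apply, e1]
  abel

namespace TameField

theorem primitive_zero {h : E → ℝ → E} (H : TameField T L h) {τ : ℝ} (hτ : 0 ≤ τ) : primitive h 0 τ = 0 := by
  rw [primitive, intervalIntegral.integral_congr (g := fun _ => 0), intervalIntegral.integral_zero]
  intro s hs
  rw [uIcc_of_le hτ] at hs
  exact H.map_zero s hs.1

theorem differentiable_primitive {h : E → ℝ → E} (H : TameField T L h) {τ : ℝ} (hτ : 0 ≤ τ) :
    Differentiable ℝ fun x => primitive h x τ := fun x =>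
  (hasFDerivAt_primitive H.continuous H.lipschitz H.nonneg H.differentiable x hτ
    ).2.differentiableAt

theorem integral_periodic {h : E → ℝ → E} (H : TameField T L h) (x : E) {τ : ℝ} (hτ : 0 ≤ τ) :
    ∫ s in τ..(τ + T), h x s = ∫ s in (0 : ℝ)..T, h x s := by
  have hi : ∀ a b, IntervalIntegrable (h x) volume a b := fun a b =>
    (continuous_section H.continuous x).intervalIntegrable _ _
  have e : ∫ s in T..(τ + T), h x s = ∫ s in (0 : ℝ)..τ, h x s := by
    have := intervalIntegral.integral_comp_add_right (a := 0) (b := τ) (h x) T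
    rw [zero_add] at this
    rw [← this]
    refine intervalIntegral.integral_congr fun s hs => ?_
    rw [uIcc_of_le hτ] at hs
    exact H.periodic x s hs.1
  have e1 := intervalIntegral.integral_add_adjacent_intervals (hi 0 τ) (hi τ (τ + T))
  have e2 := intervalIntegral.integral_add_adjacent_intervals (hi 0 T) (hi T (τ + T))
  rw [e, ← e1, add_comm] at e2
  exact (add_left_cancel e2).symm

theorem primitive_periodic {h : E → ℝ → E} (H : TameField T L h)
    (hm : ∀ x, ∫ s in (0 : ℝ)..T, h x s = 0) (x : E) (τ : ℝ) (hτ : 0 ≤ τ) :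
    primitive h x (τ + T) = primitive h x τ := by
  have hi : ∀ a b, IntervalIntegrable (h x) volume a b := fun a b =>
    (continuous_section H.continuous x).intervalIntegrable _ _
  rw [primitive, ← intervalIntegral.integral_add_adjacent_intervals (hi 0 τ) (hi τ (τ + T)),
    H.integral_periodic x hτ, hm x, add_zero, primitive]

/-- The bound of `norm_primitive_sub_le` grows with τ; zero mean makes the primitive periodic, so
only τ < T matters and the constant becomes uniform. -/
theorem lipschitz_primitive {h : E → ℝ → E} (H : TameField T L h)
    (hm : ∀ x, ∫ s in (0 : ℝ)..T, h x s = 0) {τ : ℝ} (hτ : 0 ≤ τ) (x y : E) :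
    ‖primitive h x τ - primitive h y τ‖ ≤ T * L * ‖x - y‖ := by
  obtain ⟨s, hs, e⟩ := exists_mem_Ico_eq_of_periodic (g := fun τ x => primitive h x τ)
    H.period_pos (fun τ hτ => funext fun x => H.primitive_periodic hm x τ hτ) hτ
  rw [congrFun e x, congrFun e y]
  refine (norm_primitive_sub_le H.continuous H.lipschitz x y hs.1).trans ?_
  have := H.nonneg
  exact mul_le_mul_of_nonneg_right (mul_le_mul_of_nonneg_right hs.2.le this) (norm_nonneg _)

theorem norm_fderiv_primitive_le {h : E → ℝ → E} (H : TameField T L h)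
    (hm : ∀ x, ∫ s in (0 : ℝ)..T, h x s = 0) {τ : ℝ} (hτ : 0 ≤ τ) (x : E) :
    ‖fderiv ℝ (fun y => primitive h y τ) x‖ ≤ T * L :=
  norm_fderiv_le_of_lip' ℝ (mul_nonneg H.period_pos.le H.nonneg)
    (Eventually.of_forall fun z => H.lipschitz_primitive hm hτ z x)

end TameField

end Primitive

/-! ### Tame fields: algebra -/

section TameAlgebra

variable {n : ℕ} {T L L' : ℝ}

local notation "E" => EuclideanSpace ℝ (Fin n)

theorem TameField.sub {h k : E → ℝ → E} (H : TameField T L h) (K : TameField T L' k) :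
    TameField T (L + L') (fun x τ => h x τ - k x τ) where
  nonneg := add_nonneg H.nonneg K.nonneg
  period_pos := H.period_pos
  continuous := H.continuous.sub K.continuous
  lipschitz τ hτ x y := by
    have e : h x τ - k x τ - (h y τ - k y τ) = (h x τ - h y τ) - (k x τ - k y τ) := by abel
    rw [e, add_mul]
    exact (norm_sub_le _ _).trans (add_le_add (H.lipschitz τ hτ x y) (K.lipschitz τ hτ x y))
  differentiable τ hτ := (H.differentiable τ hτ).sub (K.differentiable τ hτ)
  periodic x τ hτ := by rw [H.periodic x τ hτ, K.periodic x τ hτ]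
  map_zero τ hτ := by rw [H.map_zero τ hτ, K.map_zero τ hτ, sub_zero]

/-- The time average of a field. -/
noncomputable def timeAverage (T : ℝ) (h : E → ℝ → E) (x : E) : E :=
  T⁻¹ • ∫ s in (0 : ℝ)..T, h x s

theorem TameField.timeAverage {h : E → ℝ → E} (H : TameField T L h) :
    TameField T L (fun x _ => timeAverage T h x) where
  nonneg := H.nonneg
  period_pos := H.period_pos
  continuous := by
    have : Continuous fun p : E × ℝ => primitive h p.1 T :=
      (continuous_primitive H.continuous).comp (continuous_fst.prodMk continuous_const)
    exact this.const_smul T⁻¹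
  lipschitz _ _ x y := by
    have h1 := norm_primitive_sub_le H.continuous H.lipschitz x y H.period_pos.le
    change ‖T⁻¹ • primitive h x T - T⁻¹ • primitive h y T‖ ≤ _
    rw [← smul_sub, norm_smul, norm_inv, Real.norm_eq_abs, abs_of_pos H.period_pos,
      inv_mul_le_iff₀ H.period_pos]
    linarith
  differentiable _ _ := (H.differentiable_primitive H.period_pos.le).const_smul T⁻¹
  periodic _ _ _ := rfl
  map_zero _ _ := by
    change T⁻¹ • primitive h 0 T = 0
    rw [H.primitive_zero H.period_pos.le, smul_zero]

theorem TameField.integral_sub_timeAverage {h : E → ℝ → E} (H : TameField T L h) (x : E) :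
    ∫ s in (0 : ℝ)..T, (h x s - SecondOrderAveraging.timeAverage T h x) = 0 := by
  rw [intervalIntegral.integral_sub ((continuous_section H.continuous x).intervalIntegrable _ _)
    intervalIntegrable_const, intervalIntegral.integral_const, sub_zero,
    SecondOrderAveraging.timeAverage, smul_smul, mul_inv_cancel₀ H.period_pos.ne', one_smul,
    sub_self]

end TameAlgebra

/-! ### The second-order corrector -/

section Corrector

variable {n : ℕ} {T L LK Lb : ℝ}

local notation "E" => EuclideanSpace ℝ (Fin n)

/-- A tame field with mean zero, whose self-derivative is regular. -/
structure FastField (T L LK : ℝ) (a : E → ℝ → E) : Prop extends TameField T L a where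
  mean_zero : ∀ x, ∫ s in (0 : ℝ)..T, a x s = 0
  nonneg_selfDeriv : 0 ≤ LK
  continuous_selfDeriv : Continuous fun p : E × ℝ × ℝ => selfDeriv a p.1 p.2.1 p.2.2
  lipschitz_selfDeriv : ∀ s r x y, ‖selfDeriv a x s r - selfDeriv a y s r‖ ≤ LK * ‖x - y‖
  differentiable_selfDeriv : ∀ s r, Differentiable ℝ fun x => selfDeriv a x s r

/-- `∫₀^τ D_x a(x, s) a(x, τ) ds`, which is `D_x v₁ a` for `v₁` the primitive of `a`. -/
noncomputable def transport (a : E → ℝ → E) (x : E) (τ : ℝ) : E :=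
  primitive (fun x s => selfDeriv a x s τ) x τ

/-- `∫₀^τ D_x a(x, τ) a(x, r) dr`, which is `D_x a v₁` for `v₁` the primitive of `a`. -/
noncomputable def stretching (a : E → ℝ → E) (x : E) (τ : ℝ) : E :=
  ∫ r in (0 : ℝ)..τ, selfDeriv a x τ r

theorem TameField.fderiv_primitive {a : E → ℝ → E} (H : TameField T L a) (x : E) {τ : ℝ}
    (hτ : 0 ≤ τ) : fderiv ℝ (fun y => primitive a y τ) x =
      ∫ s in (0 : ℝ)..τ, fderiv ℝ (fun y => a y s) x :=
  (hasFDerivAt_primitive H.continuous H.lipschitz H.nonneg H.differentiable x hτ).2.fderiv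

theorem TameField.intervalIntegrable_fderiv {a : E → ℝ → E} (H : TameField T L a) (x : E) {τ : ℝ}
    (hτ : 0 ≤ τ) : IntervalIntegrable (fun s => fderiv ℝ (fun y => a y s) x) volume 0 τ :=
  (hasFDerivAt_primitive H.continuous H.lipschitz H.nonneg H.differentiable x hτ).1

theorem TameField.transport_eq {a : E → ℝ → E} (H : TameField T L a) (x : E) {τ : ℝ}
    (hτ : 0 ≤ τ) : transport a x τ = fderiv ℝ (fun y => primitive a y τ) x (a x τ) := by
  rw [H.fderiv_primitive x hτ, ContinuousLinearMap.intervalIntegral_apply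
    (H.intervalIntegrable_fderiv x hτ)]
  rfl

theorem fderiv_apply_primitive {a : E → ℝ → E}
    (hc : Continuous fun p : E × ℝ => a p.1 p.2) (x : E) (s τ : ℝ) :
    fderiv ℝ (fun y => a y s) x (primitive a x τ) = ∫ r in (0 : ℝ)..τ, selfDeriv a x s r :=
  (ContinuousLinearMap.intervalIntegral_comp_comm _
    ((continuous_section hc x).intervalIntegrable _ _)).symm

/-- At a zero of `w` the term of the product rule containing the derivative of `D` drops out, so
continuity of `D` is enough. -/
theorem hasDerivAt_clm_apply_of_eq_zero {D : ℝ → E →L[ℝ] E} {w : ℝ → E} {w' : E} {t : ℝ}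
    (hD : ContinuousAt D t) (hw : HasDerivAt w w' t) (h0 : w t = 0) :
    HasDerivAt (fun r => D r (w r)) (D t w') t := by
  rw [hasDerivAt_iff_tendsto_slope] at hw ⊢
  have hD' : Tendsto D (𝓝[≠] t) (𝓝 (D t)) := hD.tendsto.mono_left nhdsWithin_le_nhds
  refine (((isBoundedBilinearMap_apply : IsBoundedBilinearMap ℝ
    fun p : (E →L[ℝ] E) × E => p.1 p.2).continuous.tendsto (D t, w')).comp (hD'.prodMk_nhds hw)).congr fun r => ?_
  simp [slope_def_module, h0]

namespace FastField

theorem continuous_transport {a : E → ℝ → E} (H : FastField T L LK a) :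
    Continuous fun p : E × ℝ => transport a p.1 p.2 :=
  intervalIntegral.continuous_parametric_intervalIntegral_of_continuous
    (f := fun (p : E × ℝ) s => selfDeriv a p.1 s p.2)
    (H.continuous_selfDeriv.comp ((continuous_fst.comp continuous_fst).prodMk
      (continuous_snd.prodMk (continuous_snd.comp continuous_fst)))) continuous_snd

theorem continuous_stretching {a : E → ℝ → E} (H : FastField T L LK a) (x : E) :
    Continuous (stretching a x) :=
  intervalIntegral.continuous_parametric_intervalIntegral_of_continuous
    (f := fun (s : ℝ) r => selfDeriv a x s r)
    (H.continuous_selfDeriv.comp (continuous_const.prodMk continuous_id)) continuous_id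

theorem tameField_transport {a : E → ℝ → E} (H : FastField T L LK a) :
    TameField T (T * LK) (transport a) := by
  have hp : ∀ x τ, 0 ≤ τ → transport a x (τ + T) = transport a x τ := by
    intro x τ hτ
    have e : (fun y => primitive a y (τ + T)) = fun y => primitive a y τ :=
      funext fun y => H.primitive_periodic H.mean_zero y τ hτ
    rw [H.transport_eq x hτ, H.transport_eq x (add_nonneg hτ H.period_pos.le), e,
      H.periodic x τ hτ]
  have hc : ∀ τ, Continuous fun p : E × ℝ => selfDeriv a p.1 p.2 τ := fun τ =>
    H.continuous_selfDeriv.comp (continuous_fst.prodMk (continuous_snd.prodMk continuous_const))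
  refine ⟨mul_nonneg H.period_pos.le H.nonneg_selfDeriv, H.period_pos, H.continuous_transport,
    fun τ hτ x y => ?_, fun τ hτ x => ?_, hp, fun τ hτ => ?_⟩
  · obtain ⟨s, hs, e⟩ := exists_mem_Ico_eq_of_periodic (g := fun τ x => transport a x τ)
      H.period_pos (fun τ hτ => funext fun x => hp x τ hτ) hτ
    rw [congrFun e x, congrFun e y]
    refine (norm_primitive_sub_le (hc s)
      (fun r _ x y => H.lipschitz_selfDeriv r s x y) x y hs.1).trans ?_
    exact mul_le_mul_of_nonneg_right (mul_le_mul_of_nonneg_right hs.2.le H.nonneg_selfDeriv)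
      (norm_nonneg _)
  · exact (hasFDerivAt_primitive (hc τ) (fun r _ x y => H.lipschitz_selfDeriv r τ x y)
      H.nonneg_selfDeriv (fun r _ => H.differentiable_selfDeriv r τ) x hτ).2.differentiableAt
  · rw [H.transport_eq 0 hτ, H.map_zero τ hτ, _root_.map_zero]

/-- Integration by parts: `D_x v₁ v₁ = ∫ (D_x a v₁ + D_x v₁ a)`. -/
theorem fderiv_primitive_apply_primitive {a : E → ℝ → E} (H : FastField T L LK a) (x : E) {τ : ℝ}
    (hτ : 0 ≤ τ) : fderiv ℝ (fun y => primitive a y τ) x (primitive a x τ) =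
      ∫ s in (0 : ℝ)..τ, (stretching a x s + transport a x s) := by
  set D : ℝ → E →L[ℝ] E := fun t => ∫ s in (0 : ℝ)..t, fderiv ℝ (fun y => a y s) x with hD
  set u : ℝ → E := primitive a x with hu
  have hDc : ∀ t, 0 ≤ t → ContinuousOn D (Icc 0 t) := fun t ht => by
    have h1 := (intervalIntegrable_iff_integrableOn_Icc_of_le ht).1
      (H.intervalIntegrable_fderiv x ht)
    rw [← uIcc_of_le ht] at h1 ⊢
    exact intervalIntegral.continuousOn_primitive_interval h1
  have huc : Continuous u := (continuous_primitive H.continuous).comp (Continuous.prodMk_right x)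
  have hder : ∀ t ∈ Ioo 0 τ, HasDerivAt (fun r => D r (u r))
      (stretching a x t + transport a x t) t := by
    intro t ht
    -- `D` need not be differentiable in operator norm. Writing D r (u r) = D r (u t) + D r (u r - u
    -- t), the first term involves a fixed vector, for which the integrand is a continuous
    -- `stretching`-type integral, and in the second the vector vanishes at r = t.
    have h1 : HasDerivAt (fun r => D r (u t)) (stretching a x t) t := by
      have hk : Continuous fun s => ∫ r in (0 : ℝ)..t, selfDeriv a x s r :=
        intervalIntegral.continuous_parametric_intervalIntegral_of_continuous
          (f := fun (s : ℝ) r => selfDeriv a x s r)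
          (H.continuous_selfDeriv.comp (continuous_const.prodMk continuous_id)) continuous_const
      have h2 := intervalIntegral.integral_hasDerivAt_right (hk.intervalIntegrable 0 t)
        hk.stronglyMeasurable.stronglyMeasurableAtFilter hk.continuousAt
      refine h2.congr_of_eventuallyEq ?_
      filter_upwards [lt_mem_nhds ht.1] with r hr
      simp only [hD]
      rw [ContinuousLinearMap.intervalIntegral_apply (H.intervalIntegrable_fderiv x hr.le)]
      simp only [hu, fderiv_apply_primitive H.continuous]
    have h2 : HasDerivAt (fun r => D r (u r - u t)) (transport a x t) t := by
      have h3 := hasDerivAt_clm_apply_of_eq_zero (D := D) (w := fun r => u r - u t)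
        (w' := a x t) ((hDc τ hτ).continuousAt (Icc_mem_nhds ht.1 ht.2))
        ((hasDerivAt_primitive H.continuous x t).sub_const _) (sub_self _)
      rwa [H.transport_eq x ht.1.le, H.fderiv_primitive x ht.1.le]
    have h3 := h1.add h2
    refine h3.congr_of_eventuallyEq (Eventually.of_forall fun r => ?_)
    simp [map_sub]
  have hI : Continuous fun s => stretching a x s + transport a x s :=
    (H.continuous_stretching x).add (H.continuous_transport.comp (Continuous.prodMk_right x))
  rw [intervalIntegral.integral_eq_sub_of_hasDerivAt_of_le hτ
    ((hDc τ hτ).clm_apply huc.continuousOn) hder (hI.intervalIntegrable _ _),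
    H.fderiv_primitive x hτ]
  simp [hD]

/-- Integration by parts over a full period, where v₁ vanishes. So D_x a v₁ and -D_x v₁ a have the
same mean. -/
theorem integral_stretching_add_transport {a : E → ℝ → E} (H : FastField T L LK a) (x : E) :
    ∫ s in (0 : ℝ)..T, (stretching a x s + transport a x s) = 0 := by
  rw [← H.fderiv_primitive_apply_primitive x H.period_pos.le]
  have : primitive a x T = 0 := H.mean_zero x
  rw [this, _root_.map_zero]

end FastField

/-- The second-order corrector field `b - D_x v₁ a - f̄`, with `f̄` the mean of `b - D_x v₁ a`. -/
noncomputable def corrector (T : ℝ) (a b : E → ℝ → E) (x : E) (τ : ℝ) : E :=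
  (b x τ - transport a x τ) - timeAverage T (fun x τ => b x τ - transport a x τ) x

theorem FastField.tameField_corrector {a b : E → ℝ → E} (H : FastField T L LK a)
    (Hb : TameField T Lb b) :
    TameField T (Lb + T * LK + (Lb + T * LK)) (corrector T a b) :=
  (Hb.sub H.tameField_transport).sub (Hb.sub H.tameField_transport).timeAverage

theorem FastField.integral_corrector {a b : E → ℝ → E} (H : FastField T L LK a)
    (Hb : TameField T Lb b) (x : E) : ∫ s in (0 : ℝ)..T, corrector T a b x s = 0 :=
  (Hb.sub H.tameField_transport).integral_sub_timeAverage x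

end Corrector

/-! ### The near-identity transformation in terms of primitives -/

section Identification

variable {n : ℕ} {T L LK Lb δ₁ δ₂ : ℝ}

local notation "E" => EuclideanSpace ℝ (Fin n)

theorem v₁_eq_primitive {f₁ : E → ℝ → E} (x : E) {τ : ℝ} (hτ : 0 ≤ τ) :
    v₁ f₁ δ₁ δ₂ x τ = primitive (truncated δ₁ δ₂ f₁) x τ := by
  refine intervalIntegral.integral_congr fun s hs => ?_
  rw [uIcc_of_le hτ] at hs
  exact (truncated_of_nonneg hs.1).symm

/-- With b = f̂₂ and a = f̂₁, one has 2b + [v₁, a] = 2(b - D_x v₁ a) + (D_x a v₁ + D_x v₁ a), and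
the last bracket integrates to zero over a period. -/
theorem averagedField_eq_timeAverage {f₁ f₂ : E → ℝ → E}
    (H : FastField T L LK (truncated δ₁ δ₂ f₁)) (Hb : TameField T Lb (truncated δ₁ δ₂ f₂)) (x : E) :
    averagedField f₁ f₂ T δ₁ δ₂ x = timeAverage T
      (fun x τ => truncated δ₁ δ₂ f₂ x τ - transport (truncated δ₁ δ₂ f₁) x τ) x := by
  set a := truncated δ₁ δ₂ f₁ with ha
  set b := truncated δ₁ δ₂ f₂ with hb
  have hT := H.period_pos
  have e : ∫ τ in (0 : ℝ)..T, ((2 : ℝ) • cutoff δ₁ δ₂ f₂ x τ +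
      VectorField.lieBracket ℝ (fun y => v₁ f₁ δ₁ δ₂ y τ) (fun y => cutoff δ₁ δ₂ f₁ y τ) x) =
      ∫ τ in (0 : ℝ)..T, ((2 : ℝ) • (b x τ - transport a x τ) +
        (stretching a x τ + transport a x τ)) := by
    refine intervalIntegral.integral_congr fun s hs => ?_
    rw [uIcc_of_le hT.le] at hs
    have e1 : (fun y => v₁ f₁ δ₁ δ₂ y s) = fun y => primitive a y s :=
      funext fun y => v₁_eq_primitive y hs.1
    have e2 : (fun y => cutoff δ₁ δ₂ f₁ y s) = fun y => a y s :=
      funext fun y => (truncated_of_nonneg hs.1).symm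
    have e3 : cutoff δ₁ δ₂ f₂ x s = b x s := (truncated_of_nonneg hs.1).symm
    have e4 : stretching a x s = fderiv ℝ (fun y => a y s) x (primitive a x s) :=
      (fderiv_apply_primitive H.continuous x s s).symm
    have e5 : cutoff δ₁ δ₂ f₁ x s = a x s := (truncated_of_nonneg hs.1).symm
    simp only [VectorField.lieBracket, e1, e2, e3, e4, e5, H.transport_eq x hs.1,
      v₁_eq_primitive x hs.1, ← ha]
    module
  have hc1 : Continuous fun τ => b x τ - transport a x τ :=
    continuous_section (h := fun x τ => b x τ - transport a x τ)
      (Hb.sub H.tameField_transport).continuous x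
  have hc1' : Continuous fun τ => (2 : ℝ) • (b x τ - transport a x τ) := by
    simpa only [Pi.smul_def] using hc1.const_smul (2 : ℝ)
  have hc2 : Continuous fun s => stretching a x s + transport a x s :=
    (H.continuous_stretching x).add (continuous_section H.continuous_transport x)
  rw [averagedField, e, intervalIntegral.integral_add (hc1'.intervalIntegrable _ _)
    (hc2.intervalIntegrable _ _), H.integral_stretching_add_transport, add_zero,
    intervalIntegral.integral_smul, smul_smul, timeAverage, mul_inv, mul_comm (2 : ℝ)⁻¹, mul_assoc,
    inv_mul_cancel₀ two_ne_zero, mul_one]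

/-- The integrand of `w` is the corrector plus D_x a v₁ + D_x v₁ a. The latter integrates to D_x v₁
v₁, exactly what v₂ subtracts; no derivative of D_x v₁ is needed any more. -/
theorem v₂_eq_primitive {f₁ f₂ : E → ℝ → E}
    (H : FastField T L LK (truncated δ₁ δ₂ f₁)) (Hb : TameField T Lb (truncated δ₁ δ₂ f₂)) (x : E)
    {τ : ℝ} (hτ : 0 ≤ τ) : v₂ f₁ f₂ T δ₁ δ₂ x τ =
      primitive (corrector T (truncated δ₁ δ₂ f₁) (truncated δ₁ δ₂ f₂)) x τ := by
  set a := truncated δ₁ δ₂ f₁ with ha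
  set b := truncated δ₁ δ₂ f₂ with hb
  have ew : w f₁ f₂ T δ₁ δ₂ x τ = ∫ s in (0 : ℝ)..τ, (corrector T a b x s +
      (stretching a x s + transport a x s)) := by
    refine intervalIntegral.integral_congr fun s hs => ?_
    rw [uIcc_of_le hτ] at hs
    have e2 : (fun y => cutoff δ₁ δ₂ f₁ y s) = fun y => a y s :=
      funext fun y => (truncated_of_nonneg hs.1).symm
    have e3 : cutoff δ₁ δ₂ f₂ x s = b x s := (truncated_of_nonneg hs.1).symm
    have e4 : stretching a x s = fderiv ℝ (fun y => a y s) x (primitive a x s) :=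
      (fderiv_apply_primitive H.continuous x s s).symm
    simp only [averagedField_eq_timeAverage H Hb, e2, e3, corrector, e4,
      v₁_eq_primitive x hs.1, ← ha, ← hb]
    abel
  have e1 : (fun y => v₁ f₁ δ₁ δ₂ y τ) = fun y => primitive a y τ :=
    funext fun y => v₁_eq_primitive y hτ
  have hc1 : Continuous fun τ => corrector T a b x τ :=
    continuous_section (H.tameField_corrector Hb).continuous x
  have hc2 : Continuous fun s => stretching a x s + transport a x s :=
    (H.continuous_stretching x).add (continuous_section H.continuous_transport x)
  rw [v₂, ew, e1, v₁_eq_primitive x hτ, H.fderiv_primitive_apply_primitive x hτ,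
    intervalIntegral.integral_add (hc1.intervalIntegrable _ _) (hc2.intervalIntegrable _ _),
    add_sub_cancel_right, primitive]

end Identification

section NearIdentity

variable {n : ℕ} {T L LK Lb δ₁ δ₂ : ℝ}

local notation "E" => EuclideanSpace ℝ (Fin n)

/-! ### Consequences of the regularity assumption -/

theorem exists_fastField_truncated {f₁ f₂ : E → ℝ → E}
    (hreg : ∀ δ : ℝ, 0 < δ → Regularity f₁ f₂ T δ) (h₀ : 0 < δ₁) (h : δ₁ < δ₂) :
    ∃ L LK Lb, FastField T L LK (truncated δ₁ δ₂ f₁) ∧ TameField T Lb (truncated δ₁ δ₂ f₂) := by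
  have R := hreg δ₁ h₀
  have hT := R.period_pos
  obtain ⟨Lb, Hb⟩ := exists_tameField_truncated h₀ h hT R.continuous₂ R.periodic₂ R.lipschitz₂
    R.smooth₂
  obtain ⟨L, Ha⟩ := exists_tameField_truncated h₀ h hT R.continuous₁ R.periodic₁ R.lipschitz₁
    (fun τ hτ => by
      obtain ⟨U, hU, hUs, hs⟩ := R.smooth₁ τ hτ
      exact ⟨U, hU, hUs, hs.of_le (by norm_num)⟩)
  set a := truncated δ₁ δ₂ f₁ with ha
  have hmax : ∀ x τ, a x τ = a x (max τ 0) := fun x τ => by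
    rw [ha, truncated, truncated, max_eq_left (le_max_right τ 0)]
  have hC2 : ∀ τ, ContDiff ℝ 2 fun x => a x τ := fun τ => by
    obtain ⟨U, hU, hUs, hs⟩ := R.smooth₁ (max τ 0) (le_max_right _ _)
    exact contDiff_bump_smul (k := 2) h₀ h le_rfl hU hUs hs
  -- The regularity assumption at a smaller radius supplies the Lipschitz bound on a neighbourhood
  -- of the sphere ‖x‖ = δ₁.
  obtain ⟨L', hL'0, hL'⟩ := (hreg (δ₁ / 2) (by positivity)).lipschitz₁
  obtain ⟨L₃, hL30, hL3⟩ := R.lipschitz_deriv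
  obtain ⟨LK, hLK0, hLK⟩ := exists_lipschitz_selfDeriv_truncated h₀ h hT R.continuous₁ R.periodic₁
    hL'0.le hL' (fun τ hτ x hx => by
      obtain ⟨U, hU, hUs, hs⟩ := R.smooth₁ τ hτ
      exact (hs.contDiffAt (hU.mem_nhds (hUs hx))).differentiableAt (by norm_num)) hL30.le hL3
  refine ⟨L, LK, Lb, { Ha with
    mean_zero := fun x => ?_
    nonneg_selfDeriv := hLK0
    continuous_selfDeriv := continuous_selfDeriv Ha.nonneg hLK0 Ha.continuous
      (fun τ => (hC2 τ).differentiable (by norm_num)) (fun τ x y => ?_) hLK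
    lipschitz_selfDeriv := hLK
    differentiable_selfDeriv := fun s r => ?_ }, Hb⟩
  · have e : ∫ s in (0 : ℝ)..T, a x s = ∫ s in (0 : ℝ)..T, bump δ₁ δ₂ x • f₁ x s := by
      refine intervalIntegral.integral_congr fun s hs => ?_
      rw [uIcc_of_le hT.le] at hs
      exact truncated_of_nonneg hs.1
    rw [e, intervalIntegral.integral_smul, R.mean_zero, smul_zero]
  · rw [hmax x, hmax y]
    exact Ha.lipschitz _ (le_max_right _ _) x y
  · exact (((hC2 s).fderiv_right (m := 1) (by norm_num)).differentiable one_ne_zero).clm_apply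
      ((hC2 r).differentiable (by norm_num))

/-! ### The near-identity transformation -/

/-- The constant controlling the distance of the transformation to the identity. -/
noncomputable def distortion (T L LK Lb : ℝ) : ℝ :=
  T * L + T * (Lb + T * LK + (Lb + T * LK))

theorem distortion_nonneg {a b : E → ℝ → E} (H : FastField T L LK a) (Hb : TameField T Lb b) :
    0 ≤ distortion T L LK Lb := by
  have := H.period_pos; have := H.nonneg; have := H.nonneg_selfDeriv; have := Hb.nonneg
  unfold distortion; positivity

variable {ε : ℝ}

theorem nearIdentity_eq {f₁ f₂ : E → ℝ → E}
    (H : FastField T L LK (truncated δ₁ δ₂ f₁))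
    (Hb : TameField T Lb (truncated δ₁ δ₂ f₂)) (x : E) {τ : ℝ} (hτ : 0 ≤ τ) :
    nearIdentity f₁ f₂ T δ₁ δ₂ ε x τ = x - ε • primitive (truncated δ₁ δ₂ f₁) x τ -
      ε ^ 2 • primitive (corrector T (truncated δ₁ δ₂ f₁) (truncated δ₁ δ₂ f₂)) x τ := by
  rw [nearIdentity, v₁_eq_primitive x hτ, v₂_eq_primitive H Hb x hτ]

theorem norm_nearIdentity_sub_sub_le {f₁ f₂ : E → ℝ → E}
    (H : FastField T L LK (truncated δ₁ δ₂ f₁))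
    (Hb : TameField T Lb (truncated δ₁ δ₂ f₂)) (hε : 0 ≤ ε) (hε1 : ε ≤ 1) {τ : ℝ} (hτ : 0 ≤ τ)
    (x y : E) : ‖nearIdentity f₁ f₂ T δ₁ δ₂ ε x τ - nearIdentity f₁ f₂ T δ₁ δ₂ ε y τ - (x - y)‖
      ≤ ε * distortion T L LK Lb * ‖x - y‖ := by
  have Hc := H.tameField_corrector Hb
  rw [nearIdentity_eq H Hb x hτ, nearIdentity_eq H Hb y hτ]
  set a := truncated δ₁ δ₂ f₁
  set c := corrector T a (truncated δ₁ δ₂ f₂)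
  have e : x - ε • primitive a x τ - ε ^ 2 • primitive c x τ -
      (y - ε • primitive a y τ - ε ^ 2 • primitive c y τ) - (x - y) =
      -(ε • (primitive a x τ - primitive a y τ) +
        ε ^ 2 • (primitive c x τ - primitive c y τ)) := by module
  have h1 := H.lipschitz_primitive H.mean_zero hτ x y
  have h2 := Hc.lipschitz_primitive (H.integral_corrector Hb) hτ x y
  rw [e, norm_neg]
  refine (norm_add_le _ _).trans ?_
  rw [norm_smul, norm_smul, norm_pow, Real.norm_eq_abs, abs_of_nonneg hε, distortion]
  have h3 : ε ^ 2 ≤ ε := by nlinarith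
  calc ε * ‖primitive a x τ - primitive a y τ‖ + ε ^ 2 * ‖primitive c x τ - primitive c y τ‖
      ≤ ε * (T * L * ‖x - y‖) + ε * (T * (Lb + T * LK + (Lb + T * LK)) * ‖x - y‖) :=
        add_le_add (mul_le_mul_of_nonneg_left h1 hε) (mul_le_mul h3 h2 (norm_nonneg _) hε)
    _ = _ := by ring

theorem nearIdentity_zero {f₁ f₂ : E → ℝ → E}
    (H : FastField T L LK (truncated δ₁ δ₂ f₁))
    (Hb : TameField T Lb (truncated δ₁ δ₂ f₂)) {τ : ℝ} (hτ : 0 ≤ τ) :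
    nearIdentity f₁ f₂ T δ₁ δ₂ ε (0 : E) τ = 0 := by
  rw [nearIdentity_eq H Hb 0 hτ, H.primitive_zero hτ, (H.tameField_corrector Hb).primitive_zero hτ]
  simp

theorem norm_nearIdentity_sub_le {f₁ f₂ : E → ℝ → E}
    (H : FastField T L LK (truncated δ₁ δ₂ f₁))
    (Hb : TameField T Lb (truncated δ₁ δ₂ f₂)) (hε : 0 ≤ ε) (hε1 : ε ≤ 1) {τ : ℝ} (hτ : 0 ≤ τ)
    (x : E) : ‖nearIdentity f₁ f₂ T δ₁ δ₂ ε x τ - x‖ ≤ ε * distortion T L LK Lb * ‖x‖ := by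
  have := norm_nearIdentity_sub_sub_le H Hb hε hε1 hτ x 0
  rwa [nearIdentity_zero H Hb hτ, sub_zero, sub_zero] at this

/-- A perturbation of the identity with Lipschitz constant below 1. Surjectivity is not needed: the
pushforward is only ever evaluated at images of points. -/
theorem nearIdentity_injective {f₁ f₂ : E → ℝ → E}
    (H : FastField T L LK (truncated δ₁ δ₂ f₁))
    (Hb : TameField T Lb (truncated δ₁ δ₂ f₂)) (hε : 0 ≤ ε) (hε1 : ε ≤ 1)
    (hεM : ε * distortion T L LK Lb < 1) {τ : ℝ} (hτ : 0 ≤ τ) :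
    Function.Injective fun x => nearIdentity f₁ f₂ T δ₁ δ₂ ε x τ := by
  intro x y hxy
  have h1 := norm_nearIdentity_sub_sub_le H Hb hε hε1 hτ x y
  simp only at hxy
  rw [hxy, sub_self, zero_sub, norm_neg] at h1
  by_contra hne
  have : 0 < ‖x - y‖ := norm_pos_iff.2 (sub_ne_zero.2 hne)
  nlinarith

theorem hasFDerivAt_nearIdentity {f₁ f₂ : E → ℝ → E}
    (H : FastField T L LK (truncated δ₁ δ₂ f₁))
    (Hb : TameField T Lb (truncated δ₁ δ₂ f₂)) {τ : ℝ} (hτ : 0 ≤ τ) (x : E) :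
    HasFDerivAt (fun y => nearIdentity f₁ f₂ T δ₁ δ₂ ε y τ)
      (ContinuousLinearMap.id ℝ E -
        ε • fderiv ℝ (fun y => primitive (truncated δ₁ δ₂ f₁) y τ) x -
        ε ^ 2 • fderiv ℝ (fun y =>
          primitive (corrector T (truncated δ₁ δ₂ f₁) (truncated δ₁ δ₂ f₂)) y τ) x) x := by
  have h1 := (H.differentiable_primitive hτ x).hasFDerivAt
  have h2 := ((H.tameField_corrector Hb).differentiable_primitive hτ x).hasFDerivAt
  exact (((hasFDerivAt_id x).sub (h1.const_smul ε)).sub (h2.const_smul (ε ^ 2))).congr_of_eventuallyEq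
    (Eventually.of_forall fun y => nearIdentity_eq H Hb y hτ)

/-- The pushforward, evaluated at a point of the range of the transformation. -/
theorem pushforward_nearIdentity {f₁ f₂ : E → ℝ → E}
    (H : FastField T L LK (truncated δ₁ δ₂ f₁))
    (Hb : TameField T Lb (truncated δ₁ δ₂ f₂)) (hε : 0 ≤ ε) (hε1 : ε ≤ 1)
    (hεM : ε * distortion T L LK Lb < 1) {τ : ℝ} (hτ : 0 ≤ τ) (ξ : E) :
    pushforward f₁ f₂ T δ₁ δ₂ ε (nearIdentity f₁ f₂ T δ₁ δ₂ ε ξ τ) τ =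
      (originalField f₁ f₂ ε ξ τ -
        ε • fderiv ℝ (fun y => primitive (truncated δ₁ δ₂ f₁) y τ) ξ (originalField f₁ f₂ ε ξ τ) -
        ε ^ 2 • fderiv ℝ (fun y =>
          primitive (corrector T (truncated δ₁ δ₂ f₁) (truncated δ₁ δ₂ f₂)) y τ) ξ
            (originalField f₁ f₂ ε ξ τ)) +
      (ε ^ 2)⁻¹ • (-(ε • truncated δ₁ δ₂ f₁ ξ τ) -
        ε ^ 2 • corrector T (truncated δ₁ δ₂ f₁) (truncated δ₁ δ₂ f₂) ξ τ) := by
  have hinv : nearIdentityInv f₁ f₂ T δ₁ δ₂ ε (nearIdentity f₁ f₂ T δ₁ δ₂ ε ξ τ) τ = ξ :=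
    Function.leftInverse_invFun (nearIdentity_injective H Hb hε hε1 hεM hτ) ξ
  have h1 := (hasDerivAt_primitive H.continuous ξ τ).const_smul ε
  have h2 := (hasDerivAt_primitive (H.tameField_corrector Hb).continuous ξ τ).const_smul (ε ^ 2)
  have h3 : HasDerivWithinAt (fun s => nearIdentity f₁ f₂ T δ₁ δ₂ ε ξ s)
      (-(ε • truncated δ₁ δ₂ f₁ ξ τ) -
        ε ^ 2 • corrector T (truncated δ₁ δ₂ f₁) (truncated δ₁ δ₂ f₂) ξ τ) (Ici 0) τ :=
    ((h1.const_sub ξ).sub h2).hasDerivWithinAt.congr_of_mem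
      (fun s hs => nearIdentity_eq H Hb ξ hs) hτ
  simp only [pushforward, hinv]
  rw [h3.derivWithin (uniqueDiffOn_Ici 0 τ hτ), (hasFDerivAt_nearIdentity H Hb hτ ξ).fderiv]
  simp

/-- Beyond δ₂ the truncated and original fields agree, and the transformation is built so that all
terms of order ε⁻¹ and ε⁰ cancel except f̄(ξ). What remains is O(ε); it is linear in ‖ξ‖ because the
truncated fields are Lipschitz and vanish at the origin. -/
theorem norm_pushforward_sub_averagedField_le {f₁ f₂ : E → ℝ → E}
    (H : FastField T L LK (truncated δ₁ δ₂ f₁))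
    (Hb : TameField T Lb (truncated δ₁ δ₂ f₂)) (h : δ₁ < δ₂) :
    ∃ C : ℝ, 0 ≤ C ∧ ∀ (ε τ : ℝ) (ξ : E), 0 < ε → ε ≤ 1 → ε * distortion T L LK Lb < 1 → 0 ≤ τ →
      δ₂ ≤ ‖ξ‖ →
      ‖pushforward f₁ f₂ T δ₁ δ₂ ε (nearIdentity f₁ f₂ T δ₁ δ₂ ε ξ τ) τ -
        averagedField f₁ f₂ T δ₁ δ₂ (nearIdentity f₁ f₂ T δ₁ δ₂ ε ξ τ)‖ ≤ ε * (C * ‖ξ‖) := by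
  have Hc := H.tameField_corrector Hb
  have Hm := (Hb.sub H.tameField_transport).timeAverage
  have hM := distortion_nonneg H Hb
  have hT := H.period_pos
  set Lf := Lb + T * LK with hLf
  have hL := H.nonneg
  have hLb := Hb.nonneg
  have hLf0 : 0 ≤ Lf := Hm.nonneg
  refine ⟨Lf * distortion T L LK Lb + T * L * Lb + T * (Lf + Lf) * L + T * (Lf + Lf) * Lb,
    by positivity, fun ε τ ξ hε hε1 hεM hτ hξ => ?_⟩
  set y := nearIdentity f₁ f₂ T δ₁ δ₂ ε ξ τ with hy
  have ea : f₁ ξ τ = truncated δ₁ δ₂ f₁ ξ τ := by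
    rw [truncated_of_nonneg hτ, cutoff, bump_eq_one h hξ, one_smul]
  have eb : f₂ ξ τ = truncated δ₁ δ₂ f₂ ξ τ := by
    rw [truncated_of_nonneg hτ, cutoff, bump_eq_one h hξ, one_smul]
  rw [pushforward_nearIdentity H Hb hε.le hε1 hεM hτ ξ, averagedField_eq_timeAverage H Hb y,
    corrector, H.transport_eq ξ hτ, originalField, ea, eb]
  have hfy := Hm.lipschitz 0 le_rfl ξ y
  have hyξ := norm_nearIdentity_sub_le H Hb hε.le hε1 hτ ξ
  rw [← hy, norm_sub_rev] at hyξ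
  have hD1 := H.norm_fderiv_primitive_le H.mean_zero hτ ξ
  have hD2 := Hc.norm_fderiv_primitive_le (H.integral_corrector Hb) hτ ξ
  have hAn := H.lipschitz τ hτ ξ 0
  have hBn := Hb.lipschitz τ hτ ξ 0
  rw [H.map_zero τ hτ, sub_zero, sub_zero] at hAn
  rw [Hb.map_zero τ hτ, sub_zero, sub_zero] at hBn
  set A := truncated δ₁ δ₂ f₁ ξ τ
  set B := truncated δ₁ δ₂ f₂ ξ τ
  set D₁ := fderiv ℝ (fun y => primitive (truncated δ₁ δ₂ f₁) y τ) ξ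
  set D₂ := fderiv ℝ (fun y =>
    primitive (corrector T (truncated δ₁ δ₂ f₁) (truncated δ₁ δ₂ f₂)) y τ) ξ
  set m := timeAverage T fun x τ =>
    truncated δ₁ δ₂ f₂ x τ - transport (truncated δ₁ δ₂ f₁) x τ
  -- The time derivative of -ε v₁ removes ε⁻¹ A; that of -ε² v₂ turns B - D₁ A into the mean `m ξ`.
  have e : ε⁻¹ • A + B - ε • D₁ (ε⁻¹ • A + B) - ε ^ 2 • D₂ (ε⁻¹ • A + B) +
      (ε ^ 2)⁻¹ • (-(ε • A) - ε ^ 2 • (B - D₁ A - m ξ)) - m y =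
      (m ξ - m y) - ε • (D₁ B + D₂ A + ε • D₂ B) := by
    simp only [map_add, map_smul]
    match_scalars <;> field_simp <;> ring
  rw [e]
  have b1 : ‖D₁ B‖ ≤ T * L * (Lb * ‖ξ‖) :=
    (D₁.le_opNorm _).trans (mul_le_mul hD1 hBn (norm_nonneg _) (by positivity))
  have b2 : ‖D₂ A‖ ≤ T * (Lf + Lf) * (L * ‖ξ‖) :=
    (D₂.le_opNorm _).trans (mul_le_mul hD2 hAn (norm_nonneg _) (by positivity))
  have b3 : ‖ε • D₂ B‖ ≤ T * (Lf + Lf) * (Lb * ‖ξ‖) := by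
    rw [norm_smul, Real.norm_eq_abs, abs_of_pos hε]
    exact (mul_le_of_le_one_left (norm_nonneg _) hε1).trans
      ((D₂.le_opNorm _).trans (mul_le_mul hD2 hBn (norm_nonneg _) (by positivity)))
  have b4 : ‖m ξ - m y‖ ≤ Lf * (ε * distortion T L LK Lb * ‖ξ‖) :=
    hfy.trans (mul_le_mul_of_nonneg_left hyξ hLf0)
  have b5 : ‖ε • (D₁ B + D₂ A + ε • D₂ B)‖ ≤ ε * (T * L * (Lb * ‖ξ‖) +
      T * (Lf + Lf) * (L * ‖ξ‖) + T * (Lf + Lf) * (Lb * ‖ξ‖)) := by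
    rw [norm_smul, Real.norm_eq_abs, abs_of_pos hε]
    exact mul_le_mul_of_nonneg_left (norm_add₃_le.trans (add_le_add (add_le_add b1 b2) b3)) hε.le
  refine (norm_sub_le _ _).trans ((add_le_add b4 b5).trans (le_of_eq ?_))
  ring

/-- The transformed solution solves the transformed equation. -/
theorem hasDerivWithinAt_nearIdentity_comp {f₁ f₂ : E → ℝ → E}
    (H : FastField T L LK (truncated δ₁ δ₂ f₁))
    (Hb : TameField T Lb (truncated δ₁ δ₂ f₂)) (hε : 0 ≤ ε) (hε1 : ε ≤ 1)
    (hεM : ε * distortion T L LK Lb < 1) {x : ℝ → E} {τ : ℝ → ℝ} {S : Set ℝ}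
    (hτ : ∀ t ∈ S, 0 ≤ τ t) {t : ℝ} (ht : t ∈ S)
    (hx : HasDerivWithinAt x (originalField f₁ f₂ ε (x t) (τ t)) S t)
    (hτ' : HasDerivWithinAt τ ((ε ^ 2)⁻¹) S t) :
    HasDerivWithinAt (fun t => nearIdentity f₁ f₂ T δ₁ δ₂ ε (x t) (τ t))
      (pushforward f₁ f₂ T δ₁ δ₂ ε (nearIdentity f₁ f₂ T δ₁ δ₂ ε (x t) (τ t)) (τ t)) S t := by
  have Hc := H.tameField_corrector Hb
  have h1 := hasDerivWithinAt_primitive_comp H.continuous H.lipschitz H.nonneg H.differentiable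
    ht hτ hx hτ'
  have h2 := hasDerivWithinAt_primitive_comp Hc.continuous Hc.lipschitz Hc.nonneg
    Hc.differentiable ht hτ hx hτ'
  rw [pushforward_nearIdentity H Hb hε hε1 hεM (hτ t ht)]
  refine (((hx.sub (h1.const_smul ε)).sub (h2.const_smul (ε ^ 2))).congr_of_mem
    (fun r hr => nearIdentity_eq H Hb (x r) (hτ r hr)) ht).congr_deriv ?_
  module

end NearIdentity

/-! ### Comparison functions -/

/-- A decay rate that depends only on the value of a Lyapunov function. -/
theorem exists_decay_rate {X : Type*} (V W : X → ℝ) (hW : ∀ x, 0 ≤ W x)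
    (x₀ : X) (hV0 : V x₀ = 0) (hW0 : W x₀ = 0)
    (h : ∀ s, 0 < s → ∃ c, 0 < c ∧ ∀ x, s ≤ V x → c ≤ W x) :
    ∃ ρ : ℝ → ℝ, Continuous ρ ∧ (∀ s, 0 < s → 0 < ρ s) ∧ (∀ s, 0 ≤ s → ρ s ≤ s) ∧
      ∀ x, ρ (V x) ≤ W x := by
  have : Nonempty X := ⟨x₀⟩
  -- This infimum is 1-Lipschitz in s whatever `V` and `W` are. Testing with the given x yields the
  -- bound by `W`, and testing with `x₀` yields ρ s ≤ s.
  set ρ : ℝ → ℝ := fun s => ⨅ x, (W x + |s - V x|) with hρ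
  have hbdd : ∀ s, BddBelow (range fun x => W x + |s - V x|) := fun s =>
    ⟨0, by rintro _ ⟨x, rfl⟩; exact add_nonneg (hW x) (abs_nonneg _)⟩
  have hlip : ∀ s s', ρ s ≤ ρ s' + |s - s'| := fun s s' => by
    rw [← sub_le_iff_le_add]
    refine le_ciInf fun x => ?_
    have h1 : ρ s ≤ W x + |s - V x| := ciInf_le (hbdd s) x
    have h2 := abs_sub_le s s' (V x)
    linarith
  refine ⟨ρ, ?_, fun s hs => ?_, fun s hs => ?_, fun x => ?_⟩
  · refine (LipschitzWith.of_le_add fun s s' => ?_).continuous (f := ρ) (K := 1)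
    simpa [Real.dist_eq] using hlip s s'
  · obtain ⟨c, hc, hc'⟩ := h (s / 2) (by linarith)
    refine (lt_min hc (half_pos hs)).trans_le (le_ciInf fun x => ?_)
    rcases le_total (s / 2) (V x) with h1 | h1
    · exact (min_le_left _ _).trans ((hc' x h1).trans (le_add_of_nonneg_right (abs_nonneg _)))
    · have h2 := le_abs_self (s - V x)
      have h3 := hW x
      exact (min_le_right _ _).trans (by linarith)
  · refine (ciInf_le (hbdd s) x₀).trans ?_
    rw [hW0, hV0, sub_zero, zero_add, abs_of_nonneg hs]
  · refine (ciInf_le (hbdd (V x)) x).trans ?_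
    simp

/-- A logarithmic clock for the scalar equation `v' = -ρ(v)`. -/
theorem exists_clock {ρ : ℝ → ℝ} (hc : Continuous ρ) (hpos : ∀ s, 0 < s → 0 < ρ s)
    (hle : ∀ s, 0 ≤ s → ρ s ≤ s) :
    ∃ Θ : ℝ ≃o ℝ, ∀ z, HasDerivAt Θ (Real.exp z / ρ (Real.exp z)) z := by
  -- With v = exp z the equation v' = -ρ(v) reads z' = -1 / k(z), so the primitive of `k` decreases
  -- at unit speed. As ρ s ≤ s gives k ≥ 1, the primitive grows at least like z in both directions
  -- and is onto: solutions neither reach zero in finite time nor come from infinity in finite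
  -- backward time.
  set k : ℝ → ℝ := fun z => Real.exp z / ρ (Real.exp z) with hk
  have hkc : Continuous k := Real.continuous_exp.div (hc.comp Real.continuous_exp)
    fun z => (hpos _ (Real.exp_pos z)).ne'
  have hk1 : ∀ z, 1 ≤ k z := fun z => by
    rw [hk, one_le_div (hpos _ (Real.exp_pos z))]
    exact hle _ (Real.exp_pos z).le
  set θ : ℝ → ℝ := fun z => ∫ u in (0 : ℝ)..z, k u with hθ
  have hd : ∀ z, HasDerivAt θ (k z) z := fun z =>
    intervalIntegral.integral_hasDerivAt_right (hkc.intervalIntegrable _ _)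
      hkc.stronglyMeasurable.stronglyMeasurableAtFilter hkc.continuousAt
  have hmono : StrictMono θ := strictMono_of_deriv_pos fun z => by
    rw [(hd z).deriv]; exact zero_lt_one.trans_le (hk1 z)
  have hmono' : Monotone fun z => θ z - z :=
    monotone_of_deriv_nonneg (fun z => ((hd z).sub (hasDerivAt_id z)).differentiableAt) fun z => by
      have : deriv (fun z => θ z - z) z = k z - 1 := ((hd z).sub (hasDerivAt_id z)).deriv
      rw [this]; linarith [hk1 z]
  have h0 : θ 0 = 0 := by simp [hθ]
  have hsurj : Function.Surjective θ := by
    have hcont : Continuous θ := continuous_iff_continuousAt.2 fun z => (hd z).continuousAt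
    refine hcont.surjective (tendsto_atTop_mono' atTop ?_ tendsto_id)
      (tendsto_atBot_mono' atBot ?_ tendsto_id)
    · filter_upwards [eventually_ge_atTop 0] with z hz
      have := hmono' hz
      simp only [h0, id] at this ⊢; linarith
    · filter_upwards [eventually_le_atBot 0] with z hz
      have := hmono' hz
      simp only [h0, id] at this ⊢; linarith
  exact ⟨hmono.orderIsoOfSurjective θ hsurj, hd⟩

/-- The flow, for time `t`, of the scalar equation with clock `Θ`. -/
noncomputable def clockFlow (Θ : ℝ ≃o ℝ) (r t : ℝ) : ℝ :=
  if 0 < r then Real.exp (Θ.symm (Θ (Real.log r) - t)) else 0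

theorem clockFlow_of_pos (Θ : ℝ ≃o ℝ) {r : ℝ} (hr : 0 < r) (t : ℝ) :
    clockFlow Θ r t = Real.exp (Θ.symm (Θ (Real.log r) - t)) := if_pos hr

theorem clockFlow_zero (Θ : ℝ ≃o ℝ) (t : ℝ) : clockFlow Θ 0 t = 0 := if_neg (lt_irrefl _)

theorem clockFlow_nonneg (Θ : ℝ ≃o ℝ) (r t : ℝ) : 0 ≤ clockFlow Θ r t := by
  unfold clockFlow; split_ifs
  exacts [(Real.exp_pos _).le, le_rfl]

theorem clockFlow_le (Θ : ℝ ≃o ℝ) {r t : ℝ} (hr : 0 ≤ r) (ht : 0 ≤ t) : clockFlow Θ r t ≤ r := by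
  rcases hr.eq_or_lt with rfl | hr
  · rw [clockFlow_zero]
  · rw [clockFlow_of_pos Θ hr, ← Real.le_log_iff_exp_le hr, Θ.symm_apply_le]
    linarith

theorem strictMonoOn_clockFlow (Θ : ℝ ≃o ℝ) (t : ℝ) :
    StrictMonoOn (fun r => clockFlow Θ r t) (Ici 0) := by
  intro r hr r' _ hrr
  have hr' : 0 < r' := (mem_Ici.1 hr).trans_lt hrr
  simp only
  rw [clockFlow_of_pos Θ hr']
  rcases (mem_Ici.1 hr).eq_or_lt with rfl | hr
  · rw [clockFlow_zero]; exact Real.exp_pos _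
  · rw [clockFlow_of_pos Θ hr, Real.exp_lt_exp, Θ.symm.lt_iff_lt]
    exact sub_lt_sub_right (Θ.lt_iff_lt.2 (Real.log_lt_log hr hrr)) t

theorem continuousOn_clockFlow (Θ : ℝ ≃o ℝ) :
    ContinuousOn (fun p : ℝ × ℝ => clockFlow Θ p.1 p.2) (Ici 0 ×ˢ Ici 0) := by
  rintro ⟨r, t⟩ ⟨hr, ht⟩
  rcases (mem_Ici.1 hr).eq_or_lt with h0 | hr
  · simp only at h0
    subst h0
    -- The formula through the logarithm breaks down at r = 0; there the flow is squeezed between 0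
    -- and r.
    have h1 : Tendsto (fun p : ℝ × ℝ => p.1) (𝓝[Ici 0 ×ˢ Ici 0] ((0 : ℝ), t)) (𝓝 0) :=
      (continuous_fst.tendsto ((0 : ℝ), t)).mono_left nhdsWithin_le_nhds
    unfold ContinuousWithinAt
    simp only [clockFlow_zero]
    refine squeeze_zero' (Eventually.of_forall fun p => clockFlow_nonneg Θ _ _) ?_ h1
    filter_upwards [self_mem_nhdsWithin] with p hp
    exact clockFlow_le Θ hp.1 hp.2
  · refine ContinuousAt.continuousWithinAt ?_
    have h1 : ContinuousAt
        (fun p : ℝ × ℝ => Real.exp (Θ.symm (Θ (Real.log p.1) - p.2))) (r, t) := by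
      refine Real.continuous_exp.continuousAt.comp (Θ.symm.continuous.continuousAt.comp ?_)
      refine ContinuousAt.sub (Θ.continuous.continuousAt.comp ?_) continuousAt_snd
      exact continuousAt_fst.log (ne_of_gt hr)
    refine h1.congr ?_
    filter_upwards [(continuous_fst.tendsto (r, t)).eventually (lt_mem_nhds hr)] with p hp
    exact (clockFlow_of_pos Θ hp _).symm

theorem tendsto_clockFlow_atTop (Θ : ℝ ≃o ℝ) (t : ℝ) :
    Tendsto (fun r => clockFlow Θ r t) atTop atTop := by
  have h1 : Tendsto (fun r => Real.exp (Θ.symm (Θ (Real.log r) - t))) atTop atTop :=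
    Real.tendsto_exp_atTop.comp (Θ.symm.tendsto_atTop.comp
      (tendsto_atTop_add_const_right _ _ (Θ.tendsto_atTop.comp Real.tendsto_log_atTop)))
  refine h1.congr' ?_
  filter_upwards [eventually_gt_atTop 0] with r hr
  exact (clockFlow_of_pos Θ hr t).symm

theorem tendsto_clockFlow_zero (Θ : ℝ ≃o ℝ) (r : ℝ) :
    Tendsto (clockFlow Θ r) atTop (𝓝 0) := by
  by_cases hr : 0 < r
  · have h1 : Tendsto (fun t => Real.exp (Θ.symm (Θ (Real.log r) - t))) atTop (𝓝 0) :=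
      Real.tendsto_exp_atBot.comp (Θ.symm.tendsto_atBot.comp
        (tendsto_atBot_add_const_left _ _ tendsto_neg_atTop_atBot))
    exact h1.congr fun t => (clockFlow_of_pos Θ hr t).symm
  · exact tendsto_const_nhds.congr fun t => (if_neg hr).symm

theorem classKL_clockFlow (Θ : ℝ ≃o ℝ) : ClassKL (clockFlow Θ) where
  continuousOn := continuousOn_clockFlow Θ
  classKInf t ht :=
    { continuousOn := (continuousOn_clockFlow Θ).comp (f := fun r => (r, t)) (by fun_prop)
        fun r hr => ⟨hr, ht⟩
      strictMonoOn := strictMonoOn_clockFlow Θ t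
      map_zero := clockFlow_zero Θ t
      tendsto_atTop := tendsto_clockFlow_atTop Θ t }
  strictAntiOn r hr t _ t' _ htt := by
    rw [clockFlow_of_pos Θ hr, clockFlow_of_pos Θ hr, Real.exp_lt_exp, Θ.symm.lt_iff_lt]
    linarith
  tendsto_zero r _ := tendsto_clockFlow_zero Θ r

/-- The comparison principle above a threshold `m`. -/
theorem le_max_clockFlow {ρ : ℝ → ℝ} (hpos : ∀ s, 0 < s → 0 < ρ s) {Θ : ℝ ≃o ℝ}
    (hΘ : ∀ z, HasDerivAt Θ (Real.exp z / ρ (Real.exp z)) z) {v v' : ℝ → ℝ} {t m : ℝ}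
    (ht : 0 ≤ t) (hm : 0 < m)
    (hv : ∀ s ∈ Icc 0 t, HasDerivWithinAt v (v' s) (Icc 0 t) s)
    (hdec : ∀ s ∈ Icc 0 t, m ≤ v s → v' s ≤ -ρ (v s)) :
    v t ≤ max m (clockFlow Θ (v 0) t) := by
  rw [le_max_iff, or_iff_not_imp_left, not_le]
  intro hmt
  have hvc : ContinuousOn v (Icc 0 t) := fun s hs => (hv s hs).continuousWithinAt
  have hd : ∀ s ∈ Ioo 0 t, HasDerivAt v (v' s) s := fun s hs =>
    (hv s (Ioo_subset_Icc_self hs)).hasDerivAt (Icc_mem_nhds hs.1 hs.2)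
  -- If v ever dropped to m, take the last time `q` with v ≤ m. Afterwards v exceeds m and so is
  -- nonincreasing, which forces v t ≤ v q ≤ m.
  have hgt : ∀ s ∈ Icc 0 t, m < v s := by
    by_contra! hcon
    obtain ⟨s, hs, hsm⟩ := hcon
    have hK : IsCompact (Icc 0 t ∩ v ⁻¹' Iic m) :=
      isCompact_Icc.of_isClosed_subset (hvc.preimage_isClosed_of_isClosed isClosed_Icc isClosed_Iic)
        inter_subset_left
    obtain ⟨q, hq, hqmax⟩ := hK.exists_isGreatest ⟨s, hs, hsm⟩
    have hanti : AntitoneOn v (Icc q t) := by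
      refine antitoneOn_of_deriv_nonpos (convex_Icc q t)
        (hvc.mono (Icc_subset_Icc_left hq.1.1)) ?_ ?_
      all_goals
        intro p hp
        rw [interior_Icc] at hp
        have hp' : p ∈ Ioo 0 t := ⟨hq.1.1.trans_lt hp.1, hp.2⟩
      · exact (hd p hp').differentiableAt.differentiableWithinAt
      · have hpm : m < v p := by
          by_contra hcon
          exact absurd (hqmax ⟨Ioo_subset_Icc_self hp', not_lt.1 hcon⟩) (not_le.2 hp.1)
        rw [(hd p hp').deriv]
        have h1 := hdec p (Ioo_subset_Icc_self hp') hpm.le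
        have h2 := hpos (v p) (hm.trans hpm)
        linarith
    have := hanti (left_mem_Icc.2 hq.1.2) (right_mem_Icc.2 hq.1.2) hq.1.2
    exact absurd hmt (not_lt.2 (this.trans hq.2))
  have hF : AntitoneOn (fun s => Θ (Real.log (v s)) + s) (Icc 0 t) := by
    have hFd : ∀ p ∈ Ioo 0 t, HasDerivAt (fun s => Θ (Real.log (v s)) + s)
        (v p / ρ (v p) * (v' p / v p) + 1) p := by
      intro p hp
      have hvp := hm.trans (hgt p (Ioo_subset_Icc_self hp))
      have h1 := (hΘ (Real.log (v p))).comp p ((hd p hp).log hvp.ne')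
      rw [Real.exp_log hvp] at h1
      exact h1.add (hasDerivAt_id p)
    refine antitoneOn_of_deriv_nonpos (convex_Icc 0 t) ?_ ?_ ?_
    · refine (Θ.continuous.comp_continuousOn (hvc.log fun s hs => ?_)).add continuousOn_id
      exact (hm.trans (hgt s hs)).ne'
    · intro p hp
      rw [interior_Icc] at hp
      exact (hFd p hp).differentiableAt.differentiableWithinAt
    · intro p hp
      rw [interior_Icc] at hp
      have hpm := hgt p (Ioo_subset_Icc_self hp)
      have hvp := hm.trans hpm
      have hρ := hpos _ hvp
      have h1 := hdec p (Ioo_subset_Icc_self hp) hpm.le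
      have e : v p / ρ (v p) * (v' p / v p) = v' p / ρ (v p) := by field_simp
      rw [(hFd p hp).deriv, e]
      have : v' p / ρ (v p) ≤ -1 := by rw [div_le_iff₀ hρ]; linarith
      linarith
  have h1 := hF (left_mem_Icc.2 ht) (right_mem_Icc.2 ht) ht
  have hv0 : 0 < v 0 := hm.trans (hgt 0 (left_mem_Icc.2 ht))
  rw [clockFlow_of_pos Θ hv0, ← Real.log_le_iff_le_exp (hm.trans hmt), Θ.le_symm_apply]
  simp only [add_zero] at h1
  linarith

theorem ClassK.nonneg {α : ℝ → ℝ} (hα : ClassK α) {r : ℝ} (hr : 0 ≤ r) : 0 ≤ α r := by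
  rw [← hα.map_zero]
  exact hα.strictMonoOn.monotoneOn (mem_Ici.2 le_rfl) hr hr

theorem ClassK.pos {α : ℝ → ℝ} (hα : ClassK α) {r : ℝ} (hr : 0 < r) : 0 < α r := by
  rw [← hα.map_zero]
  exact hα.strictMonoOn (mem_Ici.2 le_rfl) hr.le hr

theorem ClassK.mono {α : ℝ → ℝ} (hα : ClassK α) {r s : ℝ} (hr : 0 ≤ r) (hrs : r ≤ s) :
    α r ≤ α s :=
  hα.strictMonoOn.monotoneOn hr (hr.trans hrs) hrs

/-- A class `𝒦_∞` function extends to an order isomorphism of the real line. -/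
theorem ClassKInf.exists_orderIso {α : ℝ → ℝ} (hα : ClassKInf α) :
    ∃ e : ℝ ≃o ℝ, ∀ r, 0 ≤ r → e r = α r := by
  set f : ℝ → ℝ := fun r => α (max r 0) + min r 0 with hf
  have hfr : ∀ r, 0 ≤ r → f r = α r := fun r hr => by simp [hf, hr]
  have hmono : StrictMono f := by
    intro r s hrs
    rcases le_or_gt 0 r with hr | hr
    · rw [hfr r hr, hfr s (hr.trans hrs.le)]
      exact hα.strictMonoOn hr (hr.trans hrs.le) hrs
    · have h1 : α (max r 0) = 0 := by rw [max_eq_right hr.le, hα.map_zero]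
      have h2 : 0 ≤ α (max s 0) := hα.nonneg (le_max_right _ _)
      have h3 : min r 0 < min s 0 := by rw [min_eq_left hr.le]; exact lt_min hrs hr
      simp only [hf, h1]; linarith
  have hcont : Continuous f :=
    (hα.continuousOn.comp_continuous (by fun_prop) fun r => mem_Ici.2 (le_max_right r 0)).add
      (by fun_prop)
  have hsurj : Function.Surjective f := by
    refine hcont.surjective (hα.tendsto_atTop.congr' ?_) (tendsto_id.congr' ?_)
    · filter_upwards [eventually_ge_atTop 0] with r hr using (hfr r hr).symm
    · filter_upwards [eventually_le_atBot 0] with r hr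
      simp [hf, hr, hα.map_zero]
  exact ⟨hmono.orderIsoOfSurjective f hsurj, hfr⟩

/-- Class `𝒦ℒ` is stable under rescaling both the values and the first argument. -/
theorem ClassKL.rescale {σ : ℝ → ℝ → ℝ} (hσ : ClassKL σ) (e : ℝ ≃o ℝ) (he : e 0 = 0)
    {α : ℝ → ℝ} (hα : ClassKInf α) : ClassKL (fun r t => 2 * e (σ (α (2 * r)) t)) := by
  have hα2 : ∀ r, 0 ≤ r → 0 ≤ α (2 * r) := fun r hr => hα.nonneg (by linarith)
  have hcα : ContinuousOn (fun r => α (2 * r)) (Ici 0) :=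
    hα.continuousOn.comp (by fun_prop) fun r hr => mem_Ici.2 (by linarith [mem_Ici.1 hr])
  have hc : ContinuousOn (fun p : ℝ × ℝ => 2 * e (σ (α (2 * p.1)) p.2)) (Ici 0 ×ˢ Ici 0) := by
    refine continuousOn_const.mul (e.continuous.comp_continuousOn
      (hσ.continuousOn.comp (f := fun p : ℝ × ℝ => (α (2 * p.1), p.2)) ?_
        fun p hp => ⟨hα2 _ hp.1, hp.2⟩))
    exact (hcα.comp continuousOn_fst fun p hp => hp.1).prodMk continuousOn_snd
  refine ⟨hc, fun t ht => ⟨⟨?_, ?_, ?_⟩, ?_⟩, fun r hr t ht t' ht' htt => ?_, fun r hr => ?_⟩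
  · exact hc.comp (f := fun r => (r, t)) (by fun_prop) fun r hr => ⟨hr, ht⟩
  · intro r hr s hs hrs
    have h1 := hα.strictMonoOn (show 2 * r ∈ Ici 0 from mem_Ici.2 (by linarith [mem_Ici.1 hr]))
      (show 2 * s ∈ Ici 0 from mem_Ici.2 (by linarith [mem_Ici.1 hs])) (by linarith)
    have h2 := e.lt_iff_lt.2 ((hσ.classKInf t ht).strictMonoOn (hα2 r hr) (hα2 s hs) h1)
    exact mul_lt_mul_of_pos_left h2 two_pos
  · have := (hσ.classKInf t ht).map_zero
    simp [hα.map_zero, this, he]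
  · refine Tendsto.const_mul_atTop two_pos (e.tendsto_atTop.comp
      ((hσ.classKInf t ht).tendsto_atTop.comp (hα.tendsto_atTop.comp ?_)))
    exact tendsto_id.const_mul_atTop two_pos
  · have h1 := e.lt_iff_lt.2 (hσ.strictAntiOn _ (hα.pos (show 0 < 2 * r by linarith)) ht ht' htt)
    exact mul_lt_mul_of_pos_left h1 two_pos
  · have h1 := ((e.continuous.tendsto 0).comp (hσ.tendsto_zero _ (hα2 r hr))).const_mul 2
    rw [he, mul_zero] at h1
    exact h1

/-! ### Local existence and continuation of solutions -/

section Existence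

variable {n : ℕ}

local notation "E" => EuclideanSpace ℝ (Fin n)

/-- A field that is Lipschitz off every ball around the origin is a uniform limit of Lipschitz
fields. -/
theorem exists_lipschitz_approx {F : E → ℝ → E} (hc : Continuous fun p : E × ℝ => F p.1 p.2)
    (hL : ∀ δ : ℝ, 0 < δ → ∃ L, 0 ≤ L ∧ ∀ t, LipOutside δ L fun x => F x t) (t₀ t₁ : ℝ) {η : ℝ}
    (hη : 0 < η) :
    ∃ (G : E → ℝ → E) (K : ℝ), 0 ≤ K ∧ (Continuous fun p : E × ℝ => G p.1 p.2) ∧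
      (∀ t ∈ Icc t₀ t₁, ∀ x y, ‖G x t - G y t‖ ≤ K * ‖x - y‖) ∧
      ∀ t ∈ Icc t₀ t₁, ∀ x, ‖G x t - F x t‖ ≤ η := by
  set D : E × ℝ → E := fun p => F p.1 p.2 - F 0 p.2 with hD
  have hDc : Continuous D := hc.sub (hc.comp (continuous_const.prodMk continuous_snd))
  have hC : IsCompact (Metric.closedBall (0 : E) 1 ×ˢ Icc t₀ t₁) :=
    (isCompact_closedBall _ _).prod isCompact_Icc
  obtain ⟨B, hB⟩ := hC.exists_bound_of_continuousOn hDc.continuousOn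
  obtain ⟨e, he, hu⟩ := Metric.uniformContinuousOn_iff_le.1
    (hC.uniformContinuousOn_of_continuous hc.continuousOn) η hη
  -- Chosen so that the ball of radius 2d lies in the unit ball and F oscillates there by at most η.
  set d := min (e / 2) (1 / 2) with hd
  have hd0 : 0 < d := lt_min (by positivity) (by norm_num)
  have hde : 2 * d ≤ e := by have := min_le_left (e / 2) (1 / 2); linarith
  have hd1 : 2 * d ≤ 1 := by have := min_le_right (e / 2) (1 / 2); linarith
  have hdd : d < 2 * d := by linarith
  obtain ⟨L, hL0, hLd⟩ := hL d hd0
  obtain ⟨C, hC0, -, hCb, -⟩ := exists_fderiv_bump_bounds (n := n) hd0 hdd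
  -- Near the origin F is replaced by its value there; subtracting `F 0 t` first makes the error a
  -- small multiple of the oscillation.
  refine ⟨fun x t => F 0 t + bump d (2 * d) x • D (x, t), L + C * max B 0, by positivity,
    ?_, fun t ht x y => ?_, fun t ht x => ?_⟩
  · exact (hc.comp (continuous_const.prodMk continuous_snd)).add
      (((contDiff_bump hd0 hdd).continuous.comp continuous_fst).smul hDc)
  · rw [add_sub_add_left_eq_sub]
    refine LipOutside.cutoff_smul hC0 hL0 (le_max_right B 0) hCb abs_bump_le_one
      (fun x hx => bump_eq_zero hdd hx) (fun x hx => bump_eq_one hdd hx)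
      (G := fun x => D (x, t)) (fun x y hx hy => ?_) (fun x _ hx => ?_) x y
    · simp only [hD, sub_sub_sub_cancel_right]
      exact hLd t x y hx hy
    · exact (hB (x, t) ⟨by simpa using hx.trans hd1, ht⟩).trans (le_max_left _ _)
  · rcases le_total (2 * d) ‖x‖ with hx | hx
    · simp only [bump_eq_one hdd hx, one_smul, hD, add_sub_cancel, sub_self, norm_zero]
      exact hη.le
    · have e1 : F 0 t + bump d (2 * d) x • D (x, t) - F x t =
          -((1 - bump d (2 * d) x) • (F x t - F 0 t)) := by simp only [hD]; module
      rw [e1, norm_neg, norm_smul, Real.norm_eq_abs,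
        abs_of_nonneg (sub_nonneg.2 (bump_le_one x))]
      have h1 : ‖F x t - F 0 t‖ ≤ η := by
        rw [← dist_eq_norm]
        refine hu (x, t) ⟨by simpa using hx.trans hd1, ht⟩ (0, t) ⟨by simp, ht⟩ ?_
        rw [Prod.dist_eq, dist_self, dist_zero_right, max_eq_left (norm_nonneg x)]
        exact hx.trans hde
      exact (mul_le_of_le_one_left (norm_nonneg _)
        (by linarith [bump_nonneg (δ₁ := d) (δ₂ := 2 * d) x])).trans h1

-- Picard–Lindelöf, taken at the level of the fixed point in the function space in order to retain
-- that the solution stays in the unit ball, which the limit in `exists_local_solution` uses.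
open ODE in
theorem exists_solution_mem_closedBall {G : E → ℝ → E}
    (hc : Continuous fun p : E × ℝ => G p.1 p.2) {K : ℝ} {t₀ h M : ℝ} (hK : 0 ≤ K) (hh : 0 ≤ h)
    (hGK : ∀ t ∈ Icc t₀ (t₀ + h), ∀ x y, ‖G x t - G y t‖ ≤ K * ‖x - y‖) (hM0 : 0 ≤ M) {x₀ : E}
    (hM : ∀ t ∈ Icc t₀ (t₀ + h), ∀ x ∈ Metric.closedBall x₀ 1, ‖G x t‖ ≤ M) (hMh : M * h ≤ 1) :
    ∃ α : ℝ → E, α t₀ = x₀ ∧ (∀ t, α t ∈ Metric.closedBall x₀ 1) ∧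
      ∀ t ∈ Icc t₀ (t₀ + h), HasDerivWithinAt α (G (α t) t) (Icc t₀ (t₀ + h)) t := by
  lift M to NNReal using hM0
  lift K to NNReal using hK
  have ht₀ : t₀ ∈ Icc t₀ (t₀ + h) := left_mem_Icc.2 (by linarith)
  have hf : IsPicardLindelof (fun t x => G x t) (⟨t₀, ht₀⟩ : Icc t₀ (t₀ + h)) x₀ 1 0 M K :=
    { lipschitzOnWith := fun t ht => LipschitzOnWith.of_dist_le_mul fun x _ y _ => by
        rw [dist_eq_norm, dist_eq_norm]; exact hGK t ht x y
      continuousOn := fun x _ => (continuous_section hc x).continuousOn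
      norm_le := fun t ht x hx => hM t ht x (by simpa using hx)
      mul_max_le := by simpa [hh] using hMh }
  obtain ⟨α, hα⟩ := FunSpace.exists_isFixedPt_next hf (Metric.mem_closedBall_self le_rfl)
  refine ⟨α.compProj, ?_, fun t => ?_, fun t ht => ?_⟩
  · change α.compProj ((⟨t₀, ht₀⟩ : Icc t₀ (t₀ + h)) : ℝ) = x₀
    rw [FunSpace.compProj_val, ← hα, FunSpace.next_apply₀]
  · simpa using α.compProj_mem_closedBall hf.mul_max_le (t := t)
  · apply hasDerivWithinAt_picard_Icc ht₀ hf.continuousOn_uncurry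
      α.continuous_compProj.continuousOn
      (fun _ _ ↦ α.compProj_mem_closedBall hf.mul_max_le) x₀ ht |>.congr_of_mem _ ht
    intro t' ht'
    nth_rw 1 [← hα]
    rw [FunSpace.compProj_of_mem ht', FunSpace.next_apply]

/-- Peano's theorem, for fields that are Lipschitz off every ball around the origin. -/
theorem exists_local_solution {F : E → ℝ → E} (hc : Continuous fun p : E × ℝ => F p.1 p.2)
    (hL : ∀ δ : ℝ, 0 < δ → ∃ L, 0 ≤ L ∧ ∀ t, LipOutside δ L fun x => F x t) (t₀ : ℝ) (x₀ : E) :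
    ∃ h : ℝ, 0 < h ∧ ∃ y : ℝ → E, y t₀ = x₀ ∧
      ∀ t ∈ Icc t₀ (t₀ + h), HasDerivWithinAt y (F (y t) t) (Icc t₀ (t₀ + h)) t := by
  obtain ⟨M₀, hM₀⟩ := ((isCompact_closedBall x₀ 1).prod (isCompact_Icc (a := t₀) (b := t₀ + 1))
    ).exists_bound_of_continuousOn hc.continuousOn
  -- The extra 1 absorbs the approximation error, so one `M` and one time step serve all
  -- approximating fields.
  set M := max M₀ 0 + 1 with hM
  have hM1 : 1 ≤ M := by have := le_max_right M₀ 0; linarith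
  have hM0 : 0 < M := by linarith
  set h := 1 / M with hh
  have hh0 : 0 < h := by positivity
  have hh1 : h ≤ 1 := by rw [hh, div_le_one hM0]; exact hM1
  have hMh : M * h = 1 := by rw [hh]; field_simp
  set I := Icc t₀ (t₀ + h) with hI
  have hII : I ⊆ Icc t₀ (t₀ + 1) := Icc_subset_Icc_right (by linarith)
  have hFM : ∀ t ∈ I, ∀ x ∈ Metric.closedBall x₀ 1, ‖F x t‖ ≤ M - 1 := fun t ht x hx => by
    rw [hM, add_sub_cancel_right]
    exact (hM₀ (x, t) ⟨hx, hII ht⟩).trans (le_max_left _ _)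
  have hk : ∀ k : ℕ, ∃ α : ℝ → E, α t₀ = x₀ ∧ (∀ t, α t ∈ Metric.closedBall x₀ 1) ∧
      ∀ t ∈ I, ∃ v, HasDerivWithinAt α v I t ∧ ‖v - F (α t) t‖ ≤ 1 / ((k : ℝ) + 1) := by
    intro k
    have hk0 : 0 < 1 / ((k : ℝ) + 1) := by positivity
    have hk1 : 1 / ((k : ℝ) + 1) ≤ 1 := by
      rw [div_le_one (by positivity)]; linarith [(Nat.cast_nonneg k : (0 : ℝ) ≤ k)]
    obtain ⟨G, K, hK, hGc, hGK, hGF⟩ := exists_lipschitz_approx hc hL t₀ (t₀ + h) hk0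
    obtain ⟨α, h1, h2, h3⟩ := exists_solution_mem_closedBall (x₀ := x₀) hGc hK hh0.le hGK hM0.le
      (fun t ht x hx => by
        have e : G x t = (G x t - F x t) + F x t := by abel
        rw [e]
        refine (norm_add_le _ _).trans ?_
        linarith [hGF t ht x, hFM t ht x hx]) hMh.le
    exact ⟨α, h1, h2, fun t ht => ⟨_, h3 t ht, hGF t ht _⟩⟩
  choose α hα0 hαb hαd using hk
  have hlip : ∀ k, ∀ t ∈ I, ∀ s ∈ I, ‖α k s - α k t‖ ≤ M * ‖s - t‖ := by
    intro k t ht s hs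
    choose! v hv hv' using hαd k
    refine Convex.norm_image_sub_le_of_norm_hasDerivWithin_le (f' := v) (fun r hr => hv r hr)
      (fun r hr => ?_) (convex_Icc _ _) ht hs
    have e : v r = (v r - F (α k r) r) + F (α k r) r := by abel
    rw [e]
    refine (norm_add_le _ _).trans ?_
    have hk1 : 1 / ((k : ℝ) + 1) ≤ 1 := by
      rw [div_le_one (by positivity)]; linarith [(Nat.cast_nonneg k : (0 : ℝ) ≤ k)]
    linarith [hv' r hr, hFM r hr _ (hαb k r)]
  -- Pointwise limits along a nonprincipal ultrafilter exist by compactness of the ball. They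
  -- replace the uniformly convergent subsequence of Arzelà–Ascoli: the increment estimate below is
  -- uniform in `k` and involves only the two times `s` and `t`.
  have hlim : ∀ t, ∃ y ∈ Metric.closedBall x₀ 1,
      Tendsto (fun k => α k t) (hyperfilter ℕ : Filter ℕ) (𝓝 y) := fun t =>
    (isCompact_closedBall x₀ 1).ultrafilter_le_nhds ((hyperfilter ℕ).map fun k => α k t)
      (by
        rw [le_principal_iff, Ultrafilter.mem_coe, Ultrafilter.mem_map]
        exact univ_mem' fun k => hαb k t)
  choose y hyb hy using hlim
  refine ⟨h, hh0, y, ?_, fun t ht => ?_⟩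
  · have := hy t₀
    simp only [hα0] at this
    exact (tendsto_nhds_unique this tendsto_const_nhds)
  rw [hasDerivWithinAt_iff_isLittleO, Asymptotics.isLittleO_iff]
  intro e he
  have hC : IsCompact (Metric.closedBall x₀ 1 ×ˢ I) :=
    (isCompact_closedBall _ _).prod isCompact_Icc
  obtain ⟨d, hd, hu⟩ := Metric.uniformContinuousOn_iff_le.1
    (hC.uniformContinuousOn_of_continuous hc.continuousOn) e he
  have hball : Metric.ball t (d / M) ∈ 𝓝 t := Metric.ball_mem_nhds t (by positivity)
  filter_upwards [self_mem_nhdsWithin, mem_nhdsWithin_of_mem_nhds hball] with s hs hst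
  have hk : ∀ k : ℕ, ‖α k s - α k t - (s - t) • F (α k t) t‖ ≤
      (e + 1 / ((k : ℝ) + 1)) * ‖s - t‖ := by
    intro k
    choose! v hv hv' using hαd k
    have hder : ∀ r ∈ I ∩ Metric.ball t (d / M),
        HasDerivWithinAt (fun r => α k r - r • F (α k t) t) (v r - F (α k t) t)
          (I ∩ Metric.ball t (d / M)) r := by
      intro r hr
      have h1 : HasDerivAt (fun r : ℝ => r • F (α k t) t) (F (α k t) t) r := by
        simpa using (hasDerivAt_id r).smul_const (F (α k t) t)
      exact ((hv r hr.1).mono inter_subset_left).sub h1.hasDerivWithinAt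
    have hbd : ∀ r ∈ I ∩ Metric.ball t (d / M), ‖v r - F (α k t) t‖ ≤ e + 1 / ((k : ℝ) + 1) := by
      intro r hr
      have h1 : ‖F (α k r) r - F (α k t) t‖ ≤ e := by
        rw [← dist_eq_norm]
        refine hu (α k r, r) ⟨hαb k r, hr.1⟩ (α k t, t) ⟨hαb k t, ht⟩ ?_
        have hrt : M * ‖r - t‖ ≤ d := by
          have := (mem_ball_iff_norm.1 hr.2).le
          rwa [le_div_iff₀ hM0, mul_comm] at this
        refine max_le ?_ ?_
        · rw [dist_eq_norm]; exact (hlip k t ht r hr.1).trans hrt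
        · rw [dist_eq_norm]
          exact (le_mul_of_one_le_left (norm_nonneg _) hM1).trans hrt
      have e1 : v r - F (α k t) t = (F (α k r) r - F (α k t) t) + (v r - F (α k r) r) := by abel
      rw [e1]
      exact (norm_add_le _ _).trans (add_le_add h1 (hv' r hr.1))
    have := Convex.norm_image_sub_le_of_norm_hasDerivWithin_le hder hbd
      ((convex_Icc _ _).inter (convex_ball t _)) ⟨ht, Metric.mem_ball_self (by positivity)⟩ ⟨hs, hst⟩
    refine le_trans (le_of_eq ?_) this
    congr 1
    module
  have hF : Tendsto (fun k => F (α k t) t) (hyperfilter ℕ : Filter ℕ) (𝓝 (F (y t) t)) :=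
    (hc.tendsto (y t, t)).comp ((hy t).prodMk_nhds tendsto_const_nhds)
  have h1 := (((hy s).sub (hy t)).sub (hF.const_smul (s - t))).norm
  have h2 : Tendsto (fun k : ℕ => (e + 1 / ((k : ℝ) + 1)) * ‖s - t‖) (hyperfilter ℕ : Filter ℕ)
      (𝓝 ((e + 0) * ‖s - t‖)) :=
    ((tendsto_one_div_add_atTop_nhds_zero_nat.mono_left Nat.hyperfilter_le_atTop).const_add e
      ).mul_const _
  rw [add_zero] at h2
  exact le_of_tendsto_of_tendsto' h1 h2 hk

/-- A bounded solution on `[0, b)` can be continued past `b`. -/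
theorem exists_extension {F : E → ℝ → E} (hc : Continuous fun p : E × ℝ => F p.1 p.2)
    (hL : ∀ δ : ℝ, 0 < δ → ∃ L, 0 ≤ L ∧ ∀ t, LipOutside δ L fun x => F x t) {b R : ℝ} (hb : 0 < b)
    {x : ℝ → E} (hx : ∀ t ∈ Ico 0 b, HasDerivWithinAt x (F (x t) t) (Ico 0 b) t)
    (hR : ∀ t ∈ Ico 0 b, ‖x t‖ ≤ R) :
    ∃ h : ℝ, 0 < h ∧ ∃ y : ℝ → E, (∀ t ∈ Ico 0 b, y t = x t) ∧
      ∀ t ∈ Ico 0 (b + h), HasDerivWithinAt y (F (y t) t) (Ico 0 (b + h)) t := by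
  obtain ⟨M, hM⟩ := ((isCompact_closedBall (0 : E) R).prod (isCompact_Icc (a := 0) (b := b))
    ).exists_bound_of_continuousOn hc.continuousOn
  have hlip : LipschitzOnWith (Real.toNNReal (max M 0)) x (Ico 0 b) := by
    refine LipschitzOnWith.of_dist_le_mul fun s hs t ht => ?_
    rw [dist_eq_norm, dist_eq_norm, Real.coe_toNNReal _ (le_max_right _ _)]
    exact Convex.norm_image_sub_le_of_norm_hasDerivWithin_le hx
      (fun r hr => (hM (x r, r) ⟨by simpa using hR r hr, Ico_subset_Icc_self hr⟩).trans
        (le_max_left _ _)) (convex_Ico _ _) ht hs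
  -- Boundedness of the velocity makes x Lipschitz, so a Lipschitz extension supplies the endpoint
  -- value at b.
  obtain ⟨g, hg, hgx⟩ := hlip.extend_finite_dimension
  have hgc := hg.continuous
  obtain ⟨h, hh, z, hz0, hz⟩ := exists_local_solution hc hL b (g b)
  set y : ℝ → E := fun t => if t < b then g t else z t with hy
  have hyl : ∀ t, t < b → y t = g t := fun t ht => if_pos ht
  have hyr : ∀ t, b ≤ t → y t = z t := fun t ht => if_neg (not_lt.2 ht)
  have hyx : ∀ t ∈ Ico 0 b, y t = x t := fun t ht => by rw [hyl t ht.2, hgx ht]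
  have hyb : y b = g b := by rw [hyr b le_rfl, hz0]
  have hyd : ∀ t ∈ Ico 0 b, HasDerivWithinAt y (F (y t) t) (Ico 0 b) t := fun t ht => by
    rw [hyx t ht]
    exact (hx t ht).congr_of_mem hyx ht
  have hzd : ∀ t ∈ Icc b (b + h), HasDerivWithinAt y (F (y t) t) (Icc b (b + h)) t := fun t ht => by
    rw [hyr t ht.1]
    exact (hz t ht).congr_of_mem (fun r hr => hyr r hr.1) ht
  refine ⟨h, hh, y, hyx, fun t ht => ?_⟩
  rcases lt_trichotomy t b with htb | rfl | htb
  · refine (hyd t ⟨ht.1, htb⟩).mono_of_mem_nhdsWithin ?_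
    filter_upwards [self_mem_nhdsWithin, mem_nhdsWithin_of_mem_nhds (Iio_mem_nhds htb)] with r hr hr'
    exact ⟨hr.1, hr'⟩
  · have hd : ∀ r ∈ Ioo 0 t, HasDerivAt y (F (y r) r) r := fun r hr =>
      (hyd r ⟨hr.1.le, hr.2⟩).hasDerivAt (Ico_mem_nhds hr.1 hr.2)
    have hIoo : Ioo 0 t ∈ 𝓝[<] t := Ioo_mem_nhdsLT hb
    have hcl : Tendsto y (𝓝[<] t) (𝓝 (y t)) := by
      rw [hyb]
      refine ((hgc.tendsto t).mono_left nhdsWithin_le_nhds).congr' ?_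
      filter_upwards [self_mem_nhdsWithin] with r hr using (hyl r hr).symm
    -- At the junction the left derivative is the limit of the derivatives, since y is continuous
    -- there; the right derivative comes from the new piece.
    have hleft : HasDerivWithinAt y (F (y t) t) (Iic t) t := by
      refine hasDerivWithinAt_Iic_of_tendsto_deriv
        (fun r hr => (hd r hr).differentiableAt.differentiableWithinAt)
        (hcl.mono_left (nhdsWithin_mono _ fun r hr => hr.2)) hIoo ?_
      have h1 : Tendsto (fun r => F (y r) r) (𝓝[<] t) (𝓝 (F (y t) t)) :=
        (hc.tendsto (y t, t)).comp (hcl.prodMk_nhds (tendsto_id.mono_left nhdsWithin_le_nhds))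
      refine h1.congr' ?_
      filter_upwards [hIoo] with r hr using (hd r hr).deriv.symm
    refine (hleft.union (hzd t ⟨le_rfl, by linarith⟩)).mono fun r hr => ?_
    rcases le_total r t with h1 | h1
    · exact Or.inl h1
    · exact Or.inr ⟨h1, hr.2.le⟩
  · refine (hzd t ⟨htb.le, ht.2.le⟩).mono_of_mem_nhdsWithin ?_
    filter_upwards [self_mem_nhdsWithin, mem_nhdsWithin_of_mem_nhds (Ioi_mem_nhds htb)] with r hr hr'
    exact ⟨le_of_lt hr', hr.2.le⟩

theorem timeDomain_coe (b : ℝ) : timeDomain (b : EReal) = Ico 0 b := by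
  ext t; simp [timeDomain]

theorem convex_timeDomain (ts : EReal) : Convex ℝ (timeDomain ts) :=
  OrdConnected.convex ⟨fun _ hs _ ht _ hr =>
    ⟨hs.1.trans hr.1, (EReal.coe_le_coe_iff.2 hr.2).trans_lt ht.2⟩⟩

theorem IsSolution.zero_mem {ε : ℝ} {f : E → ℝ → E} {x₀ : E} {τ₀ : ℝ} {ts : EReal} {x : ℝ → E}
    {τ : ℝ → ℝ} (h : IsSolution ε f x₀ τ₀ ts x τ) : (0 : ℝ) ∈ timeDomain ts :=
  ⟨le_rfl, by simpa using h.pos⟩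

theorem IsSolution.time_eq {ε : ℝ} {f : E → ℝ → E} {x₀ : E} {τ₀ : ℝ} {ts : EReal} {x : ℝ → E}
    {τ : ℝ → ℝ} (h : IsSolution ε f x₀ τ₀ ts x τ) {t : ℝ} (ht : t ∈ timeDomain ts) :
    τ t = τ₀ + t * (ε ^ 2)⁻¹ := by
  have hd : ∀ r ∈ timeDomain ts, HasDerivWithinAt (fun r => τ r - r * (ε ^ 2)⁻¹) 0
      (timeDomain ts) r := fun r hr => by
    have h1 : HasDerivAt (fun r : ℝ => r * (ε ^ 2)⁻¹) ((ε ^ 2)⁻¹) r := by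
      simpa using (hasDerivAt_id r).mul_const ((ε ^ 2)⁻¹)
    exact ((h.deriv_τ r hr).sub h1.hasDerivWithinAt).congr_deriv (sub_self _)
  have := Convex.norm_image_sub_le_of_norm_hasDerivWithin_le (C := 0) hd (fun _ _ => by simp)
    (convex_timeDomain ts) h.zero_mem ht
  have := norm_le_zero_iff.1 (this.trans (zero_mul _).le)
  rw [h.init_τ] at this
  linarith

/-- Bounded maximal solutions are global. -/
theorem IsMaximalSolution.eq_top {ε : ℝ} {f : E → ℝ → E}
    (hf : ContinuousOn (fun p : E × ℝ => f p.1 p.2) (univ ×ˢ Ici 0))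
    (hL : ∀ δ : ℝ, 0 < δ → ∃ L, 0 ≤ L ∧ ∀ τ, 0 ≤ τ → LipOutside δ L fun x => f x τ)
    {x₀ : E} {τ₀ : ℝ} (hτ₀ : 0 ≤ τ₀) {ts : EReal} {x : ℝ → E} {τ : ℝ → ℝ}
    (h : IsMaximalSolution ε f x₀ τ₀ ts x τ) {R : ℝ} (hR : ∀ t ∈ timeDomain ts, ‖x t‖ ≤ R) :
    ts = ⊤ := by
  obtain ⟨hs, hmax⟩ := h
  induction ts using EReal.rec with
  | bot => exact absurd hs.pos (by simp)
  | top => rfl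
  | coe b =>
    exfalso
    have hb : 0 < b := by simpa using hs.pos
    have hτt : ∀ t, 0 ≤ t → 0 ≤ τ₀ + t * (ε ^ 2)⁻¹ := fun t ht => by positivity
    -- Solving the τ-equation explicitly leaves a nonautonomous equation in x. The `max` makes the
    -- field continuous for all real times and changes nothing for t ≥ 0.
    set F : E → ℝ → E := fun x t => f x (max (τ₀ + t * (ε ^ 2)⁻¹) 0) with hF
    have hFeq : ∀ x t, 0 ≤ t → F x t = f x (τ₀ + t * (ε ^ 2)⁻¹) := fun x t ht => by
      simp only [hF, max_eq_left (hτt t ht)]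
    have hFc : Continuous fun p : E × ℝ => F p.1 p.2 :=
      hf.comp_continuous (f := fun p : E × ℝ => (p.1, max (τ₀ + p.2 * (ε ^ 2)⁻¹) 0))
        (by fun_prop) fun p => ⟨mem_univ _, mem_Ici.2 (le_max_right _ _)⟩
    have hFL : ∀ δ : ℝ, 0 < δ → ∃ L, 0 ≤ L ∧ ∀ t, LipOutside δ L fun x => F x t := fun δ hδ => by
      obtain ⟨L, hL0, hL⟩ := hL δ hδ
      exact ⟨L, hL0, fun t => hL _ (le_max_right _ _)⟩
    have hxd : ∀ t ∈ Ico 0 b, HasDerivWithinAt x (F (x t) t) (Ico 0 b) t := fun t ht => by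
      rw [hFeq _ t ht.1]
      have ht' : t ∈ timeDomain (b : EReal) := by rwa [timeDomain_coe]
      have := hs.deriv_x t ht'
      rwa [hs.time_eq ht', timeDomain_coe] at this
    obtain ⟨r, hr, y, hyx, hyd⟩ := exists_extension hFc hFL hb hxd
      (fun t ht => hR t (by rwa [timeDomain_coe]))
    have hlt : (b : EReal) < ((b + r : ℝ) : EReal) := EReal.coe_lt_coe_iff.2 (by linarith)
    have hsol : IsSolution ε f x₀ τ₀ ((b + r : ℝ) : EReal) y (fun t => τ₀ + t * (ε ^ 2)⁻¹) := by
      refine ⟨hs.pos.trans hlt, ?_, by simp, fun t ht => hτt t ht.1, fun t ht => ?_, fun t _ => ?_⟩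
      · rw [hyx 0 ⟨le_rfl, hb⟩, hs.init_x]
      · rw [timeDomain_coe] at ht ⊢
        rw [← hFeq _ t ht.1]
        exact hyd t ht
      · have h1 : HasDerivAt (fun r : ℝ => r * (ε ^ 2)⁻¹) ((ε ^ 2)⁻¹) t := by
          simpa using (hasDerivAt_id t).mul_const ((ε ^ 2)⁻¹)
        exact (h1.const_add τ₀).hasDerivWithinAt
    have := hmax _ y _ hsol hlt.le fun t ht =>
      ⟨hyx t (by rwa [timeDomain_coe] at ht), (hs.time_eq ht).symm⟩
    exact hlt.ne' this

end Existence

/-! ### Lyapunov decrease in the transformed coordinates -/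

section Decrease

variable {n : ℕ} {T L LK Lb : ℝ}

local notation "E" => EuclideanSpace ℝ (Fin n)

/-- Away from the support of the truncation, the average does not depend on the truncation. -/
theorem averagedField_congr {f₁ f₂ : E → ℝ → E} {δ₁ δ₂ δ₁' δ₂' : ℝ} (h : δ₁ < δ₂) (h' : δ₁' < δ₂')
    {x : E} (hx : δ₂ < ‖x‖) (hx' : δ₂' < ‖x‖) :
    averagedField f₁ f₂ T δ₁ δ₂ x = averagedField f₁ f₂ T δ₁' δ₂' x := by
  have hc : ∀ᶠ y in 𝓝 x, ∀ (f : E → ℝ → E) τ, cutoff δ₁ δ₂ f y τ = cutoff δ₁' δ₂' f y τ := by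
    filter_upwards [(isOpen_lt continuous_const continuous_norm).mem_nhds hx,
      (isOpen_lt continuous_const continuous_norm).mem_nhds hx'] with y hy hy' f τ
    rw [cutoff, cutoff, bump_eq_one h (le_of_lt hy), bump_eq_one h' (le_of_lt hy')]
  have hv : ∀ᶠ y in 𝓝 x, ∀ τ, v₁ f₁ δ₁ δ₂ y τ = v₁ f₁ δ₁' δ₂' y τ := by
    filter_upwards [hc] with y hy τ
    simp only [v₁, hy]
  unfold averagedField VectorField.lieBracket
  congr 2
  funext τ
  have e1 : fderiv ℝ (fun y => v₁ f₁ δ₁ δ₂ y τ) x = fderiv ℝ (fun y => v₁ f₁ δ₁' δ₂' y τ) x :=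
    Filter.EventuallyEq.fderiv_eq (hv.mono fun y hy => hy τ)
  have e2 : fderiv ℝ (fun y => cutoff δ₁ δ₂ f₁ y τ) x =
      fderiv ℝ (fun y => cutoff δ₁' δ₂' f₁ y τ) x :=
    Filter.EventuallyEq.fderiv_eq (hc.mono fun y hy => hy f₁ τ)
  simp only [e1, e2, hc.self_of_nhds f₁ τ, hc.self_of_nhds f₂ τ, hv.self_of_nhds τ]

theorem PositiveDefinite.nonneg {φ : E → ℝ} (h : PositiveDefinite φ) (x : E) : 0 ≤ φ x := by
  obtain ⟨α, hα, hle⟩ := h.lower_bound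
  exact (hα.nonneg (norm_nonneg x)).trans (hle x)

/-- The error of the averaged equation, in the transformed coordinates, is controlled by `ε φ`. -/
theorem exists_pushforward_bound {f₁ f₂ : E → ℝ → E} {V φ : E → ℝ} {d : ℝ} (hd : 0 < d)
    (Ly : Lyapunov f₁ f₂ T d (2 * d) (5 * d) V φ)
    (H : FastField T L LK (truncated d (2 * d) f₁))
    (Hb : TameField T Lb (truncated d (2 * d) f₂)) :
    ∃ C ε₁ : ℝ, 0 ≤ C ∧ 0 < ε₁ ∧ ∀ (ε τ : ℝ) (ξ : E), 0 < ε → ε ≤ ε₁ → ε ≤ 1 →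
      ε * distortion T L LK Lb ≤ 1 / 4 → 0 ≤ τ →
      5 * d ≤ ‖nearIdentity f₁ f₂ T d (2 * d) ε ξ τ‖ →
      ‖pushforward f₁ f₂ T d (2 * d) ε (nearIdentity f₁ f₂ T d (2 * d) ε ξ τ) τ -
        averagedField f₁ f₂ T d (2 * d) (nearIdentity f₁ f₂ T d (2 * d) ε ξ τ)‖ ≤
        ε * (C * φ (nearIdentity f₁ f₂ T d (2 * d) ε ξ τ)) := by
  obtain ⟨α, hα, hαφ⟩ := Ly.posDef.lower_bound
  have h5d : 0 < 5 * d := by linarith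
  rcases Ly.growth with ⟨ε₀, L₀, hε₀, hL₀, hg⟩ | ⟨α₃, hα₃, hφ⟩
  · have hp : 0 < α (5 * d) := hα.pos h5d
    -- Where ‖y‖ ≥ 5d one has φ(y) ≥ α(5d), so the constant 1 in the growth bound is absorbed into
    -- φ.
    refine ⟨L₀ * (1 + (α (5 * d))⁻¹), ε₀, by positivity, hε₀,
      fun ε τ ξ hε hεε₁ _ _ hτ hy => ?_⟩
    set y := nearIdentity f₁ f₂ T d (2 * d) ε ξ τ
    have h1 := hg y τ ε hy hτ hε hεε₁
    rw [remainder, norm_smul, norm_inv, Real.norm_eq_abs, abs_of_pos hε, inv_mul_le_iff₀ hε] at h1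
    refine h1.trans (mul_le_mul_of_nonneg_left ?_ hε.le)
    rw [mul_assoc]
    refine mul_le_mul_of_nonneg_left ?_ hL₀.le
    have h2 : α (5 * d) ≤ φ y := (hα.mono h5d.le hy).trans (hαφ y)
    have h3 : 1 ≤ (α (5 * d))⁻¹ * φ y := by rwa [le_inv_mul_iff₀ hp, mul_one]
    linarith
  · have hp : 0 < α₃ (5 * d) := hα₃.pos h5d
    obtain ⟨C, hC0, hC⟩ := norm_pushforward_sub_averagedField_le H Hb (show d < 2 * d by linarith)
    -- The remainder is bounded by C ‖ξ‖; then ‖ξ‖ ≤ 2 ‖y‖, and α₃(5d) ‖y‖ ≤ φ(y) where ‖y‖ ≥ 5d.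
    refine ⟨C * (2 * (α₃ (5 * d))⁻¹), 1, by positivity, one_pos,
      fun ε τ ξ hε _ hε1 hεM hτ hy => ?_⟩
    have hdist := norm_nearIdentity_sub_le H Hb hε.le hε1 hτ ξ
    set y := nearIdentity f₁ f₂ T d (2 * d) ε ξ τ with hydef
    have hdist' : ‖y - ξ‖ ≤ 1 / 4 * ‖ξ‖ :=
      hdist.trans (mul_le_mul_of_nonneg_right hεM (norm_nonneg _))
    have h1 : ‖y‖ ≤ ‖ξ‖ + ‖y - ξ‖ := by
      have := norm_add_le ξ (y - ξ); rwa [add_sub_cancel] at this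
    have h2 : ‖ξ‖ ≤ ‖y‖ + ‖y - ξ‖ := by
      have := norm_sub_le y (y - ξ); rwa [sub_sub_cancel] at this
    have hξ : 2 * d ≤ ‖ξ‖ := by linarith
    have hξy : ‖ξ‖ ≤ 2 * ‖y‖ := by linarith [norm_nonneg y]
    refine (hC ε τ ξ hε hε1 (by linarith) hτ hξ).trans (mul_le_mul_of_nonneg_left ?_ hε.le)
    rw [mul_assoc]
    refine mul_le_mul_of_nonneg_left (hξy.trans ?_) hC0
    rw [mul_assoc]
    refine mul_le_mul_of_nonneg_left ?_ two_pos.le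
    rw [le_inv_mul_iff₀ hp]
    exact (mul_le_mul_of_nonneg_right (hα₃.mono h5d.le hy) (norm_nonneg y)).trans (hφ y)

/-- The derivative of `V` along the averaged field, with the truncation adapted to the point. -/
noncomputable def dissipation (f₁ f₂ : E → ℝ → E) (T : ℝ) (V : E → ℝ) (x : E) : ℝ :=
  -inner ℝ (gradient V x) (averagedField f₁ f₂ T (‖x‖ / 5) (2 * (‖x‖ / 5)) x)

/-- For ‖x‖ ≥ 5d both truncation radii, 2d and 2‖x‖/5, lie strictly below ‖x‖, so the two averages
agree at x. -/
theorem exists_le_dissipation {f₁ f₂ : E → ℝ → E} {V φ : E → ℝ} {d : ℝ} (hd : 0 < d)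
    (Ly : Lyapunov f₁ f₂ T d (2 * d) (5 * d) V φ) :
    ∃ c, 0 < c ∧ ∀ x, 5 * d ≤ ‖x‖ → c * φ x ^ 2 ≤ dissipation f₁ f₂ T V x ∧
      inner ℝ (gradient V x) (averagedField f₁ f₂ T d (2 * d) x) = -dissipation f₁ f₂ T V x := by
  obtain ⟨c, hc, h⟩ := Ly.decrease
  refine ⟨c, hc, fun x hx => ?_⟩
  have e : averagedField f₁ f₂ T d (2 * d) x =
      averagedField f₁ f₂ T (‖x‖ / 5) (2 * (‖x‖ / 5)) x :=
    averagedField_congr (by linarith) (by linarith) (by linarith) (by linarith)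
  have h1 := h x hx
  rw [dissipation, ← e]
  exact ⟨by linarith, by ring⟩

/-- The comparison function `ρ` of the Lyapunov function does not depend on the truncation. -/
theorem exists_rate {f₁ f₂ : E → ℝ → E} {V φ : E → ℝ}
    (Ly : ∀ d : ℝ, 0 < d → Lyapunov f₁ f₂ T d (2 * d) (5 * d) V φ) {α₂ : ℝ → ℝ}
    (hα₂ : ClassKInf α₂) (hV : ∀ x, V x ≤ α₂ ‖x‖) :
    ∃ ρ : ℝ → ℝ, Continuous ρ ∧ (∀ s, 0 < s → 0 < ρ s) ∧ (∀ s, 0 ≤ s → ρ s ≤ s) ∧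
      ∀ x, ρ (V x) ≤ dissipation f₁ f₂ T V x / 2 := by
  obtain ⟨c₂, hc₂, hgrad⟩ := (Ly 1 one_pos).gradient_le
  have hφ := (Ly 1 one_pos).posDef
  obtain ⟨α, hα, hαφ⟩ := hφ.lower_bound
  -- At the origin the truncation radii degenerate to zero and nothing is known about the average;
  -- it is irrelevant because φ(0) = 0 forces the gradient of V to vanish.
  have hW0 : dissipation f₁ f₂ T V 0 = 0 := by
    have h1 := hgrad 0
    rw [hφ.map_zero, mul_zero, norm_le_zero_iff] at h1
    rw [dissipation, h1, inner_zero_left, neg_zero]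
  have hV0 : V 0 = 0 := by
    refine le_antisymm ?_ ((Ly 1 one_pos).nonneg 0)
    have := hV 0
    rwa [norm_zero, hα₂.map_zero] at this
  refine exists_decay_rate V (fun x => dissipation f₁ f₂ T V x / 2) (fun x => ?_) 0 hV0
    (by rw [hW0, zero_div]) fun s hs => ?_
  · rcases eq_or_ne x 0 with rfl | hx
    · rw [hW0, zero_div]
    · have hx' : 0 < ‖x‖ := norm_pos_iff.2 hx
      -- The scale is chosen so that 5d = ‖x‖: every nonzero point is covered by some truncation.
      obtain ⟨c, hc, h⟩ := exists_le_dissipation (by positivity) (Ly (‖x‖ / 5) (by positivity))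
      have h1 := (h x (by linarith)).1
      have h2 : 0 ≤ c * φ x ^ 2 := by positivity
      linarith
  · obtain ⟨e, he⟩ := hα₂.exists_orderIso
    have he0 : e 0 = 0 := by rw [he 0 le_rfl, hα₂.map_zero]
    have hr : 0 < e.symm s := by rwa [e.lt_symm_apply, he0]
    obtain ⟨c, hc, h⟩ := exists_le_dissipation (by positivity) (Ly (e.symm s / 5) (by positivity))
    have hαr := hα.pos hr
    refine ⟨c * α (e.symm s) ^ 2 / 2, by positivity, fun x hx => ?_⟩
    have hrx : e.symm s ≤ ‖x‖ := by
      rw [e.symm_apply_le, he _ (norm_nonneg x)]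
      exact hx.trans (hV x)
    have h1 := (h x (by linarith)).1
    have h2 : α (e.symm s) ≤ φ x := (hα.mono hr.le hrx).trans (hαφ x)
    have h3 : c * α (e.symm s) ^ 2 ≤ c * φ x ^ 2 :=
      mul_le_mul_of_nonneg_left (pow_le_pow_left₀ hαr.le h2 2) hc.le
    linarith

theorem exists_threshold {c M a b : ℝ} (hc : 0 < c) (hM : 0 ≤ M) (ha : 0 < a) (hb : 0 ≤ b) :
    ∃ e : ℝ, 0 < e ∧ ∀ ε, 0 < ε → ε < e → ε ≤ a ∧ ε ≤ 1 ∧ ε * M ≤ 1 / 4 ∧ ε * b ≤ c := by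
  refine ⟨min (min a 1) (min (1 / (4 * (M + 1))) (c / (b + 1))), by positivity, fun ε hε h => ?_⟩
  obtain ⟨h1, h2⟩ := lt_min_iff.1 h
  obtain ⟨h3, h4⟩ := lt_min_iff.1 h1
  obtain ⟨h5, h6⟩ := lt_min_iff.1 h2
  rw [lt_div_iff₀ (by positivity)] at h5 h6
  exact ⟨h3.le, h4.le, by linarith, by linarith⟩

/-- The comparison estimate for the Lyapunov function along transformed solutions. -/
theorem exists_lyapunov_estimate {f₁ f₂ : E → ℝ → E} {V φ : E → ℝ} {d : ℝ} (hd : 0 < d)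
    (Ly : Lyapunov f₁ f₂ T d (2 * d) (5 * d) V φ)
    (H : FastField T L LK (truncated d (2 * d) f₁))
    (Hb : TameField T Lb (truncated d (2 * d) f₂)) {α₂ : ℝ → ℝ} (hα₂ : ClassKInf α₂)
    (hV : ∀ x, V x ≤ α₂ ‖x‖) {ρ : ℝ → ℝ} (hρ : ∀ s, 0 < s → 0 < ρ s)
    (hρV : ∀ x, ρ (V x) ≤ dissipation f₁ f₂ T V x / 2) {Θ : ℝ ≃o ℝ}
    (hΘ : ∀ z, HasDerivAt Θ (Real.exp z / ρ (Real.exp z)) z) :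
    ∃ e : ℝ, 0 < e ∧ ∀ ε, 0 < ε → ε < e → ε ≤ 1 ∧ ε * distortion T L LK Lb ≤ 1 / 4 ∧
      ∀ (x₀ : E) (τ₀ : ℝ) (ts : EReal) (x : ℝ → E) (τ : ℝ → ℝ),
        IsSolution ε (originalField f₁ f₂ ε) x₀ τ₀ ts x τ → ∀ t ∈ timeDomain ts,
          V (nearIdentity f₁ f₂ T d (2 * d) ε (x t) (τ t)) ≤ max (α₂ (5 * d))
            (clockFlow Θ (V (nearIdentity f₁ f₂ T d (2 * d) ε (x 0) (τ 0))) t) := by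
  have h5d : 0 < 5 * d := by linarith
  obtain ⟨C, ε₁, hC0, hε₁, hC⟩ := exists_pushforward_bound hd Ly H Hb
  obtain ⟨c₂, hc₂, hgrad⟩ := Ly.gradient_le
  obtain ⟨c, hc, hdiss⟩ := exists_le_dissipation hd Ly
  -- The perturbation may spend c φ² / 2, at most half of the dissipation; the other half dominates
  -- ρ(V).
  obtain ⟨e, he, hthr⟩ := exists_threshold (half_pos hc) (distortion_nonneg H Hb) hε₁
    (mul_nonneg hc₂.le hC0)
  refine ⟨e, he, fun ε hε hεe => ?_⟩
  obtain ⟨hεε₁, hε1, hεM, hεc⟩ := hthr ε hε hεe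
  refine ⟨hε1, hεM, fun x₀ τ₀ ts x τ hs t ht => ?_⟩
  set y : ℝ → E := fun s => nearIdentity f₁ f₂ T d (2 * d) ε (x s) (τ s) with hy
  have hsub : Icc 0 t ⊆ timeDomain ts := fun s hs =>
    ⟨hs.1, (EReal.coe_le_coe_iff.2 hs.2).trans_lt ht.2⟩
  have hyd : ∀ s ∈ timeDomain ts, HasDerivWithinAt y
      (pushforward f₁ f₂ T d (2 * d) ε (y s) (τ s)) (timeDomain ts) s := fun s hs' =>
    hasDerivWithinAt_nearIdentity_comp H Hb hε.le hε1 (by linarith) hs.nonneg hs'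
      (hs.deriv_x s hs') (hs.deriv_τ s hs')
  have hvd : ∀ s ∈ Icc 0 t, HasDerivWithinAt (fun s => V (y s))
      (inner ℝ (gradient V (y s)) (pushforward f₁ f₂ T d (2 * d) ε (y s) (τ s))) (Icc 0 t) s := by
    intro s hs'
    have h1 := (Ly.contDiff.differentiable one_ne_zero (y s)).hasGradientAt.hasFDerivAt
    exact h1.comp_hasDerivWithinAt s ((hyd s (hsub hs')).mono hsub)
  refine le_max_clockFlow (v := fun s => V (y s)) hρ hΘ ht.1 (hα₂.pos h5d) hvd fun s hs' hms => ?_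
  have hys : 5 * d ≤ ‖y s‖ := by
    by_contra hcon
    have := hα₂.strictMonoOn (norm_nonneg (y s)) h5d.le (not_le.1 hcon)
    exact absurd (hms.trans (hV _)) (not_le.2 this)
  have hφ0 := Ly.posDef.nonneg (y s)
  obtain ⟨h1, h2⟩ := hdiss (y s) hys
  have h3 := hC ε (τ s) (x s) hε hεε₁ hε1 hεM (hs.nonneg s (hsub hs')) hys
  set p := pushforward f₁ f₂ T d (2 * d) ε (y s) (τ s)
  set m := averagedField f₁ f₂ T d (2 * d) (y s)
  have h4 : inner ℝ (gradient V (y s)) (p - m) ≤ c / 2 * φ (y s) ^ 2 := by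
    refine (real_inner_le_norm _ _).trans
      ((mul_le_mul (hgrad _) h3 (norm_nonneg _) (by positivity)).trans ?_)
    have : c₂ * φ (y s) * (ε * (C * φ (y s))) = ε * (c₂ * C) * φ (y s) ^ 2 := by ring
    rw [this]
    exact mul_le_mul_of_nonneg_right hεc (by positivity)
  rw [inner_sub_right] at h4
  have h5 := hρV (y s)
  linarith

end Decrease

end SecondOrderAveraging

/-! ### Assembly: a single 𝒦ℒ function for all residuals -/

theorem corollary2 {n : ℕ}
    (f₁ f₂ : EuclideanSpace ℝ (Fin n) → ℝ → EuclideanSpace ℝ (Fin n)) (T : ℝ)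
    (hreg : ∀ δ₁ : ℝ, 0 < δ₁ → SecondOrderAveraging.Regularity f₁ f₂ T δ₁)
    (hlyap : ∃ V φ : EuclideanSpace ℝ (Fin n) → ℝ, ∀ ϵ δ₁ δ₂ δ₃ : ℝ, 0 < ϵ → 0 < δ₁ →
      SecondOrderAveraging.Admissible ϵ δ₁ δ₂ δ₃ →
        SecondOrderAveraging.Lyapunov f₁ f₂ T δ₁ δ₂ δ₃ V φ) :
    SecondOrderAveraging.UGpAS (SecondOrderAveraging.originalField f₁ f₂) := by
  open SecondOrderAveraging in
  obtain ⟨V, φ, hlyap⟩ := hlyap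
  -- With ϵ = 1 admissibility asks for δ₂ ≥ 2d and δ₃ > 4d.
  have Ly : ∀ d : ℝ, 0 < d → Lyapunov f₁ f₂ T d (2 * d) (5 * d) V φ := fun d hd =>
    hlyap 1 d (2 * d) (5 * d) one_pos hd ⟨hd.le, by linarith, by linarith⟩
  obtain ⟨α₁, α₂, hα₁, hα₂, hV⟩ := (Ly 1 one_pos).bounds
  obtain ⟨ρ, hρc, hρ, hρle, hρV⟩ := exists_rate Ly hα₂ fun x => (hV x).2
  obtain ⟨Θ, hΘ⟩ := exists_clock hρc hρ hρle
  obtain ⟨e₁, he₁⟩ := hα₁.exists_orderIso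
  obtain ⟨e₂, he₂⟩ := hα₂.exists_orderIso
  have he₁0 : e₁.symm 0 = 0 :=
    e₁.symm_apply_eq.2 (by rw [he₁ 0 le_rfl, hα₁.map_zero])
  have he₂0 : e₂.symm 0 = 0 :=
    e₂.symm_apply_eq.2 (by rw [he₂ 0 le_rfl, hα₂.map_zero])
  -- The clock, α₁ and α₂ are all fixed before ν. The two factors 2 in the rescaling pay for ‖x t‖ ≤
  -- 2 ‖y‖ and ‖y₀‖ ≤ 2 ‖x₀‖.
  have hβ := (classKL_clockFlow Θ).rescale e₁.symm he₁0 hα₂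
  refine ⟨_, hβ, fun ν hν => ?_⟩
  have hm : 0 < α₁ (ν / 2) := hα₁.pos (half_pos hν)
  -- The level α₂(5d), below which V is no longer controlled, then corresponds to ‖y‖ ≤ ν/2, that
  -- is, to ‖x t‖ ≤ ν.
  obtain ⟨d, hd, hdm⟩ : ∃ d : ℝ, 0 < d ∧ α₂ (5 * d) = α₁ (ν / 2) := by
    have h1 : 0 < e₂.symm (α₁ (ν / 2)) := by
      rw [← he₂0]; exact e₂.symm.lt_iff_lt.2 hm
    refine ⟨e₂.symm (α₁ (ν / 2)) / 5, by positivity, ?_⟩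
    rw [mul_div_cancel₀ _ (by norm_num : (5 : ℝ) ≠ 0), ← he₂ _ h1.le, e₂.apply_symm_apply]
  obtain ⟨L, LK, Lb, H, Hb⟩ :=
    exists_fastField_truncated hreg hd (show d < 2 * d by linarith)
  obtain ⟨e, he, hest⟩ := exists_lyapunov_estimate hd (Ly d hd) H Hb hα₂ (fun x => (hV x).2) hρ
    hρV hΘ
  refine ⟨e, he, fun ε hε hεe x₀ τ₀ hτ₀ ts x τ => ?_⟩
  obtain ⟨hε1, hεM, hest⟩ := hest ε hε hεe
  have key : IsSolution ε (originalField f₁ f₂ ε) x₀ τ₀ ts x τ → ∀ t ∈ timeDomain ts,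
      ‖x t‖ ≤ 2 * e₁.symm (clockFlow Θ (α₂ (2 * ‖x₀‖)) t) + ν := by
    intro hs t ht
    have h1 := hest x₀ τ₀ ts x τ hs t ht
    have hdist : ∀ s ∈ timeDomain ts,
        ‖nearIdentity f₁ f₂ T d (2 * d) ε (x s) (τ s) - x s‖ ≤ 1 / 4 * ‖x s‖ := fun s hs' =>
      (norm_nearIdentity_sub_le H Hb hε.le hε1 (hs.nonneg s hs') (x s)).trans
        (mul_le_mul_of_nonneg_right hεM (norm_nonneg _))
    have ht' := hdist t ht
    have h0' := hdist 0 hs.zero_mem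
    rw [hs.init_x] at h1 h0'
    set y := nearIdentity f₁ f₂ T d (2 * d) ε (x t) (τ t)
    set y₀ := nearIdentity f₁ f₂ T d (2 * d) ε x₀ (τ 0)
    have hxy : ‖x t‖ ≤ 2 * ‖y‖ := by
      have := norm_sub_le y (y - x t)
      rw [sub_sub_cancel] at this
      linarith [norm_nonneg y]
    have hy₀ : ‖y₀‖ ≤ 2 * ‖x₀‖ := by
      have := norm_add_le x₀ (y₀ - x₀)
      rw [add_sub_cancel] at this
      linarith [norm_nonneg x₀]
    have hVy₀ : V y₀ ≤ α₂ (2 * ‖x₀‖) := (hV y₀).2.trans (hα₂.mono (norm_nonneg _) hy₀)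
    have hflow : clockFlow Θ (V y₀) t ≤ clockFlow Θ (α₂ (2 * ‖x₀‖)) t := by
      have h2 := (Ly 1 one_pos).nonneg y₀
      exact (strictMonoOn_clockFlow Θ t).monotoneOn h2 (h2.trans hVy₀) hVy₀
    have hy : ‖y‖ ≤ e₁.symm (max (α₁ (ν / 2)) (clockFlow Θ (α₂ (2 * ‖x₀‖)) t)) := by
      rw [e₁.le_symm_apply, he₁ _ (norm_nonneg y)]
      rw [hdm] at h1
      exact (hV y).1.trans (h1.trans (max_le_max_left _ hflow))
    have hmono : Monotone e₁.symm := e₁.symm.monotone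
    have hν2 : e₁.symm (α₁ (ν / 2)) = ν / 2 := by
      rw [← he₁ _ (half_pos hν).le, e₁.symm_apply_apply]
    have hnn : 0 ≤ e₁.symm (clockFlow Θ (α₂ (2 * ‖x₀‖)) t) := by
      rw [← he₁0]; exact hmono (clockFlow_nonneg Θ _ _)
    rw [hmono.map_max, hν2] at hy
    have := max_le_add_of_nonneg (half_pos hν).le hnn
    linarith
  refine ⟨key, fun hmax => ?_⟩
  have hR := hreg 1 one_pos
  refine hmax.eq_top (R := 2 * e₁.symm (α₂ (2 * ‖x₀‖)) + ν) ?_ (fun δ hδ => ?_) hτ₀ fun t ht => ?_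
  · exact (hR.continuous₁.const_smul ε⁻¹).add hR.continuous₂
  · obtain ⟨L₁, hL₁0, hL₁⟩ := (hreg δ hδ).lipschitz₁
    obtain ⟨L₂, hL₂0, hL₂⟩ := (hreg δ hδ).lipschitz₂
    refine ⟨ε⁻¹ * L₁ + L₂, by positivity, fun τ hτ => ?_⟩
    refine LipOutside.add (fun x y hx hy => ?_) fun x y hx hy => hL₂ x y hx hy τ hτ
    rw [← smul_sub, norm_smul, norm_inv, Real.norm_eq_abs, abs_of_pos hε, mul_assoc]
    exact mul_le_mul_of_nonneg_left (hL₁ x y hx hy τ hτ) (by positivity)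
  · refine (key hmax.1 t ht).trans ?_
    have := e₁.symm.monotone
      (clockFlow_le Θ (hα₂.nonneg (show 0 ≤ 2 * ‖x₀‖ by positivity)) ht.1)
    linarith
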